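/- Let $n\ge 2$, $0<a<1$, $\gamma>0$, let $\Omega_a=\{x\in\mathbb R^n: a<|x|<1\}$, with exterior unit normal $\nu$ on $\partial\Omega_a$, and consider for real-valued $u$ the bulk-boundary eigenvalue problem $$\begin{cases}\Delta^2u=\lambda^4u&\text{in }\Omega_a,\\ \partial_\nu u=0&\text{on }\partial\Omega_a,\\ -\partial_\nu(\Delta u)=\gamma\lambda^4u&\text{on }\partial\Omega_a.\end{cases}\qquad(*)$$ Let $H^2_*(\Omega_a)=\{u\in H^2(\Omega_a):\partial_\nu u=0\text{ on }\partial\Omega_a\text{ in the sense of traces}\}$. A weak eigenfunction of $(*)$ for $\lambda$ is a $u\in H^2_*(\Omega_a)$, $u\ne0$, such that $$\int_{\Omega_a}\Delta u\,\Delta v=\lambda^4\Big(\int_{\Omega_a}uv+\gamma\int_{\partial\Omega_a}uv\Big)\qquad\text{for all }v\in H^2_*(\Omega_a);$$ a classical eigenfunction is a $u\in C^4(\Omega_a)\cap C^3(\overline{\Omega_a})$, $u\not\equiv0$, satisfying $(*)$ pointwise. Then the eigenfunctions of $(*)$ for $\lambda=0$ are exactly the non-zero constants: a function $u$ is a weak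 eigenfunction for $\lambda=0$ if and only if there is a constant $c\neq0$ with $u=c$ almost everywhere in $\Omega_a$, and it is a classical eigenfunction for $\lambda=0$ if and only if there is a constant $c\ne0$ with $u=c$ on $\overline{\Omega_a}$. -/

import Mathlib

open Set Filter Topology MeasureTheory
open scoped ContDiff ENNReal InnerProductSpace

noncomputable section

namespace BulkBoundary

/-- The Euclidean space `ℝⁿ`. -/
abbrev Rn (n : ℕ) : Type := EuclideanSpace ℝ (Fin n)

/-! ### Weak derivatives and the Sobolev space `H²` -/

/-- The classical partial derivative `∂ᵢ φ`. -/
def partialDeriv {n : ℕ} (i : Fin n) (φ : Rn n → ℝ) (x : Rn n) : ℝ :=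
  fderiv ℝ φ x (EuclideanSpace.single i 1)

/-- `g` is a weak `i`-th partial derivative of `u` in the open set `Ω`:
`∫_Ω u ∂ᵢφ = - ∫_Ω g φ` for every test function `φ ∈ C_c^∞(Ω)`. -/
def HasWeakPartial {n : ℕ} (Ω : Set (Rn n)) (i : Fin n) (u g : Rn n → ℝ) : Prop :=
  LocallyIntegrableOn u Ω ∧ LocallyIntegrableOn g Ω ∧
    ∀ φ : Rn n → ℝ, ContDiff ℝ ∞ φ → HasCompactSupport φ → tsupport φ ⊆ Ω →
      ∫ x in Ω, u x * partialDeriv i φ x = - ∫ x in Ω, g x * φ x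

open Classical in
/-- The weak partial derivative `∂ᵢ u` in `Ω` (determined up to null sets; `0` if there is none). -/
def weakPartial {n : ℕ} (Ω : Set (Rn n)) (i : Fin n) (u : Rn n → ℝ) : Rn n → ℝ :=
  if h : ∃ g, HasWeakPartial Ω i u g then h.choose else 0

/-- `u ∈ H²(Ω)`: `u` and all its weak derivatives of order one and two exist and lie in `L²(Ω)`. -/
structure MemH2 {n : ℕ} (Ω : Set (Rn n)) (u : Rn n → ℝ) : Prop where
  memLp : MemLp u 2 (volume.restrict Ω)
  exists_first : ∀ i, ∃ g, HasWeakPartial Ω i u g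
  memLp_first : ∀ i, MemLp (weakPartial Ω i u) 2 (volume.restrict Ω)
  exists_second : ∀ i j, ∃ g, HasWeakPartial Ω j (weakPartial Ω i u) g
  memLp_second : ∀ i j, MemLp (weakPartial Ω j (weakPartial Ω i u)) 2 (volume.restrict Ω)

/-- The weak Laplacian `Δu = ∑ᵢ ∂ᵢ∂ᵢ u` of `u ∈ H²(Ω)`. -/
def weakLaplacian {n : ℕ} (Ω : Set (Rn n)) (u : Rn n → ℝ) (x : Rn n) : ℝ :=
  ∑ i, weakPartial Ω i (weakPartial Ω i u) x

/-- The bilinear form `𝒬(u, v) = ∫_Ω Δu Δv`. -/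
def bilapForm {n : ℕ} (Ω : Set (Rn n)) (u v : Rn n → ℝ) : ℝ :=
  ∫ x in Ω, weakLaplacian Ω u x * weakLaplacian Ω v x

/-- The `H²(Ω)`-distance (sum of the `L²(Ω)`-distances of the function and of its first and second
derivatives) from the smooth function `φ` to `u ∈ H²(Ω)`. -/
def h2Dist {n : ℕ} (Ω : Set (Rn n)) (φ u : Rn n → ℝ) : ℝ≥0∞ :=
  eLpNorm (fun x => φ x - u x) 2 (volume.restrict Ω) +
  ∑ i, eLpNorm (fun x => partialDeriv i φ x - weakPartial Ω i u x) 2 (volume.restrict Ω) +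
  ∑ i, ∑ j, eLpNorm (fun x => partialDeriv j (partialDeriv i φ) x -
    weakPartial Ω j (weakPartial Ω i u) x) 2 (volume.restrict Ω)

/-- Weak partial derivatives in an open set are unique up to null sets. -/
theorem HasWeakPartial.ae_eq {n : ℕ} {Ω : Set (Rn n)} (hΩ : IsOpen Ω) {i : Fin n}
    {u g₁ g₂ : Rn n → ℝ} (h₁ : HasWeakPartial Ω i u g₁) (h₂ : HasWeakPartial Ω i u g₂) :
    g₁ =ᵐ[volume.restrict Ω] g₂ := by
  have key := hΩ.ae_eq_zero_of_integral_contDiff_smul_eq_zero (μ := volume)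
    (f := fun x => g₁ x - g₂ x) (h₁.2.1.sub h₂.2.1) ?_
  · rw [Filter.EventuallyEq, ae_restrict_iff' hΩ.measurableSet]
    filter_upwards [key] with x hx hxΩ
    exact sub_eq_zero.1 (hx hxΩ)
  · intro φ hφ hc hs
    have hint : ∀ g : Rn n → ℝ, LocallyIntegrableOn g Ω →
        Integrable (fun x => g x * φ x) (volume.restrict Ω) := by
      intro g hg
      have hI : IntegrableOn g (tsupport φ) := hg.integrableOn_compact_subset hs hc
      have h3 : IntegrableOn (fun x => g x * φ x) (tsupport φ) :=
        hI.mul_continuousOn hφ.continuous.continuousOn hc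
      have h4 : Integrable (fun x => g x * φ x) := by
        refine (integrableOn_iff_integrable_of_support_subset ?_).1 h3
        intro x hx
        exact subset_tsupport φ (right_ne_zero_of_mul hx)
      exact h4.integrableOn
    have e := (h₁.2.2 φ hφ hc hs).symm.trans (h₂.2.2 φ hφ hc hs)
    have e' : ∫ x in Ω, (g₁ x * φ x - g₂ x * φ x) = 0 := by
      rw [integral_sub (hint _ h₁.2.1) (hint _ h₂.2.1)]
      linarith
    rw [← e', ← setIntegral_eq_integral_of_forall_compl_eq_zero (s := Ω)]
    · refine integral_congr_ae (Eventually.of_forall fun x => ?_)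
      simp only [smul_eq_mul]
      ring
    · intro x hx
      have : φ x = 0 := by
        by_contra h
        exact hx (hs (subset_tsupport φ h))
      simp [this]

/-- `weakPartial` is a weak partial derivative as soon as there is one. -/
theorem hasWeakPartial_weakPartial {n : ℕ} {Ω : Set (Rn n)} {i : Fin n} {u : Rn n → ℝ}
    (h : ∃ g, HasWeakPartial Ω i u g) : HasWeakPartial Ω i u (weakPartial Ω i u) := by
  unfold weakPartial
  rw [dif_pos h]
  exact h.choose_spec

/-! ### The annulus, its boundary, and traces -/

/-- The open annulus `Ω_a = {x ∈ ℝⁿ : a < |x| < 1}`. -/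
def annulus (n : ℕ) (a : ℝ) : Set (Rn n) := {x | a < ‖x‖ ∧ ‖x‖ < 1}

/-- The closure of the annulus, `{x ∈ ℝⁿ : a ≤ |x| ≤ 1}`. -/
def closedAnnulus (n : ℕ) (a : ℝ) : Set (Rn n) := {x | a ≤ ‖x‖ ∧ ‖x‖ ≤ 1}

/-- The boundary of the annulus: the two spheres of radii `a` and `1`. -/
def annulusBoundary (n : ℕ) (a : ℝ) : Set (Rn n) := {x | ‖x‖ = a ∨ ‖x‖ = 1}

/-- The exterior unit normal on the boundary of the annulus: `x / |x|` on the outer sphere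
and `- x / |x|` on the inner sphere. -/
def outwardNormal {n : ℕ} (a : ℝ) (x : Rn n) : Rn n :=
  if ‖x‖ = a then -(‖x‖⁻¹ • x) else ‖x‖⁻¹ • x

/-- The surface measure of the sphere of radius `r` centred at the origin of `ℝⁿ`:
`r ^ (n - 1)` times the image, under `y ↦ r y`, of the surface measure of the unit sphere. -/
def sphereMeasure (n : ℕ) (r : ℝ) : Measure (Rn n) :=
  ENNReal.ofReal (r ^ (n - 1)) •
    ((volume : Measure (Rn n)).toSphere).map (fun y => r • y.1)

/-- The surface measure on the boundary of the annulus. -/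
def boundaryMeasure (n : ℕ) (a : ℝ) : Measure (Rn n) :=
  sphereMeasure n a + sphereMeasure n 1

/-- `g` is the boundary trace `u|_{∂Ω_a} ∈ L²(∂Ω_a)` of `u ∈ H²(Ω_a)`, that is, the value at `u` of
the extension by continuity to `H²(Ω_a)` of the restriction of smooth functions to the boundary. -/
def HasTrace {n : ℕ} (a : ℝ) (u g : Rn n → ℝ) : Prop :=
  MemLp g 2 (boundaryMeasure n a) ∧
    ∃ φ : ℕ → Rn n → ℝ, (∀ k, ContDiff ℝ ∞ (φ k)) ∧
      Tendsto (fun k => h2Dist (annulus n a) (φ k) u) atTop (𝓝 0) ∧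
      Tendsto (fun k => eLpNorm (fun x => φ k x - g x) 2 (boundaryMeasure n a)) atTop (𝓝 0)

/-- `g` is the trace `∂_ν u ∈ L²(∂Ω_a)` of the normal derivative of `u ∈ H²(Ω_a)`, that is, the
value at `u` of the extension by continuity to `H²(Ω_a)` of the map `φ ↦ ∇φ|_{∂Ω_a} · ν` on smooth
functions. -/
def HasNormalTrace {n : ℕ} (a : ℝ) (u g : Rn n → ℝ) : Prop :=
  MemLp g 2 (boundaryMeasure n a) ∧
    ∃ φ : ℕ → Rn n → ℝ, (∀ k, ContDiff ℝ ∞ (φ k)) ∧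
      Tendsto (fun k => h2Dist (annulus n a) (φ k) u) atTop (𝓝 0) ∧
      Tendsto (fun k => eLpNorm (fun x => fderiv ℝ (φ k) x (outwardNormal a x) - g x) 2
        (boundaryMeasure n a)) atTop (𝓝 0)

/-- The space `H²_*(Ω_a) = {u ∈ H²(Ω_a) : ∂_ν u = 0 on ∂Ω_a}`. -/
def MemH2Star {n : ℕ} (a : ℝ) (u : Rn n → ℝ) : Prop :=
  MemH2 (annulus n a) u ∧ HasNormalTrace a u 0

/-! ### The eigenvalue problem

`Δ²u = λ⁴ u` in `Ω_a`, `∂_ν u = 0` and `-∂_ν(Δu) = γ λ⁴ u` on `∂Ω_a`. -/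

/-- Weak eigenfunctions: `u ∈ H²_*(Ω_a)` is not (a.e.) zero and
`∫_{Ω_a} Δu Δv = λ⁴ (∫_{Ω_a} u v + γ ∫_{∂Ω_a} u v)` for all `v ∈ H²_*(Ω_a)`, where the boundary
integral is taken over the traces of `u` and `v`. -/
def IsWeakEigenfunction {n : ℕ} (a γ lam : ℝ) (u : Rn n → ℝ) : Prop :=
  MemH2Star a u ∧ ¬ (u =ᵐ[volume.restrict (annulus n a)] 0) ∧
    ∃ g, HasTrace a u g ∧ ∀ v h : Rn n → ℝ, MemH2Star a v → HasTrace a v h →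
      bilapForm (annulus n a) u v =
        lam ^ 4 * ((∫ x in annulus n a, u x * v x) + γ * ∫ x, g x * h x ∂(boundaryMeasure n a))

/-- Classical eigenfunctions: `u ∈ C⁴(Ω_a) ∩ C³(closure of Ω_a)` is not identically zero and
satisfies the differential equation and the boundary conditions pointwise. Boundary values of
derivatives are taken within the closed annulus. -/
structure IsClassicalEigenfunction {n : ℕ} (a γ lam : ℝ) (u : Rn n → ℝ) : Prop where
  contDiffOn_interior : ContDiffOn ℝ 4 u (annulus n a)
  contDiffOn_closed : ContDiffOn ℝ 3 u (closedAnnulus n a)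
  ne_zero : ∃ x ∈ annulus n a, u x ≠ 0
  equation : ∀ x ∈ annulus n a, Laplacian.laplacian (Laplacian.laplacian u) x = lam ^ 4 * u x
  neumann : ∀ x ∈ annulusBoundary n a,
    fderivWithin ℝ u (closedAnnulus n a) x (outwardNormal a x) = 0
  third_order : ∀ x ∈ annulusBoundary n a,
    -(fderivWithin ℝ (InnerProductSpace.laplacianWithin u (closedAnnulus n a))
      (closedAnnulus n a) x (outwardNormal a x)) = γ * lam ^ 4 * u x

end BulkBoundary

end

/-! At `λ = 0` the right-hand side of the weak equation vanishes. Testing with `v = u` gives `∫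
(Δu)² = 0`, so `Δu = 0` a.e. Green's identity `∫ |∇u|² + ∫ u Δu = ∫_∂ u ∂_ν u` then has zero
boundary term, so `∇u = 0`, and `u` is a.e. constant because the annulus is connected for `n ≥ 2`.

A classical eigenfunction is treated in two stages. The function `w = Δu` is harmonic with zero
normal derivative, hence a constant `c`. The divergence theorem for `∇u` gives `c |Ω_a| = ∫_∂ ∂_ν u
= 0`, so `u` is itself harmonic with zero normal derivative, hence constant.

Both arguments rest on the divergence theorem on the annulus, `integral_divergence`, for fields
continuous up to the boundary and `C¹` only inside. In polar coordinates the flux `G(r)` through the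
sphere of radius `r` has weak derivative `r^(n-1) ∫ div F`, as testing with radial functions shows,
and `integral_eq_sub_of_weak_deriv` integrates it. That lemma, like the weak case, uses
`ae_const_of_weak_fderiv_eq_zero`, proved by mollification. Green's identity reaches `H²_*` by
approximation in `green_memH2Star`. -/

noncomputable section

namespace BulkBoundary

/-! ### Functions with vanishing weak gradient -/

open scoped Convolution in
/-- A function whose weak gradient vanishes is a.e. constant, on an open set that is exhausted by
connected open sets at positive distance from its complement. -/
theorem ae_const_of_weak_fderiv_eq_zero {E : Type*} [NormedAddCommGroup E] [InnerProductSpace ℝ E]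
    [FiniteDimensional ℝ E] [MeasurableSpace E] [BorelSpace E] (μ : Measure E) [μ.IsAddHaarMeasure]
    {Ω : Set E} (hΩ : IsOpen Ω) {f : E → ℝ} (hf : IntegrableOn f Ω μ)
    (hw : ∀ φ : E → ℝ, ContDiff ℝ ∞ φ → HasCompactSupport φ → tsupport φ ⊆ Ω → ∀ v,
      ∫ x in Ω, f x * fderiv ℝ φ x v ∂μ = 0)
    {U : ℕ → Set E} {δ : ℕ → ℝ} (hδ : ∀ k, 0 < δ k) (hδ0 : Tendsto δ atTop (𝓝 0))
    (hU : ∀ k, IsOpen (U k)) (hUc : ∀ k, IsPreconnected (U k))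
    (hUΩ : ∀ k, ∀ x ∈ U k, Metric.closedBall x (δ k) ⊆ Ω)
    (hex : ∀ x ∈ Ω, ∀ᶠ k in atTop, x ∈ U k) :
    ∃ c : ℝ, f =ᵐ[μ.restrict Ω] fun _ => c := by
  -- Extension by zero makes the mollifications defined on all of `E`; on `U k` they do not see the
  -- jump at the boundary of `Ω`.
  set g : E → ℝ := Ω.indicator f with hg
  have hgi : Integrable g μ := (integrable_indicator_iff hΩ.measurableSet).2 hf
  -- The fixed ratio 2 of outer to inner radius is what a.e. convergence of the mollifications
  -- requires (`K = 2`).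
  let φ : ℕ → ContDiffBump (0 : E) := fun k => ⟨δ k / 2, δ k, half_pos (hδ k), half_lt_self (hδ k)⟩
  let L := ContinuousLinearMap.lsmul ℝ ℝ (E := ℝ)
  have hlim := ContDiffBump.ae_convolution_tendsto_right_of_locallyIntegrable (μ := μ) (φ := φ)
    (l := atTop) (K := 2) (g := g) hδ0
    (Eventually.of_forall fun k => by simp only [φ]; linarith) hgi.locallyIntegrable
  have hder : ∀ k x, HasFDerivAt ((φ k).normed μ ⋆[L, μ] g)
      ((fderiv ℝ ((φ k).normed μ) ⋆[L.precompL E, μ] g) x) x := fun k x =>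
    (φ k).hasCompactSupport_normed.hasFDerivAt_convolution_left L
      (φ k).contDiff_normed hgi.locallyIntegrable x
  -- The derivative of the mollification at `x` is, up to sign, `f` integrated against the
  -- derivative of `y ↦ φ (x - y)`. For `x ∈ U k` this is an admissible test function, supported in
  -- a ball of radius `δ k` inside `Ω`.
  have hzero : ∀ k, ∀ x ∈ U k, fderiv ℝ ((φ k).normed μ ⋆[L, μ] g) x = 0 := by
    intro k x hx
    rw [(hder k x).fderiv]
    ext v
    have hce : ConvolutionExistsAt (fderiv ℝ ((φ k).normed μ)) g x (L.precompL E) μ :=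
      ((φ k).hasCompactSupport_normed.fderiv (𝕜 := ℝ)).convolutionExists_left _
        ((φ k).contDiff_normed.continuous_fderiv (n := ∞) (by simp)) hgi.locallyIntegrable x
    rw [convolution, ContinuousLinearMap.integral_apply hce.integrable v]
    have e : ∀ y, fderiv ℝ (fun z => (φ k).normed μ (x - z)) y v
        = - fderiv ℝ ((φ k).normed μ) (x - y) v := by
      intro y
      have h1 : HasFDerivAt ((φ k).normed μ) (fderiv ℝ ((φ k).normed μ) (x - y)) (x - y) :=
        (((φ k).contDiff_normed (n := 1)).differentiable (by simp) _).hasFDerivAt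
      have h2 : HasFDerivAt (fun z : E => x - z) (-ContinuousLinearMap.id ℝ E) y :=
        (hasFDerivAt_id y).const_sub x
      have h3 : HasFDerivAt (fun z => (φ k).normed μ (x - z)) _ y := h1.comp y h2
      rw [h3.fderiv]
      simp
    have hts : tsupport (fun z => (φ k).normed μ (x - z)) ⊆ Metric.closedBall x (δ k) := by
      refine closure_minimal ?_ Metric.isClosed_closedBall
      intro z hz
      have : x - z ∈ Function.support ((φ k).normed μ) := hz
      rw [(φ k).support_normed_eq] at this
      rw [Metric.mem_closedBall, dist_comm, dist_eq_norm]
      exact (mem_ball_zero_iff.1 this).le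
    have key := hw (fun z => (φ k).normed μ (x - z))
      ((φ k).contDiff_normed.comp (contDiff_const.sub contDiff_id))
      (HasCompactSupport.of_support_subset_isCompact (isCompact_closedBall x (δ k))
        ((subset_tsupport _).trans hts)) (hts.trans (hUΩ k x hx)) v
    rw [← integral_sub_left_eq_self _ μ x]
    simp only [e] at key
    rw [← integral_indicator hΩ.measurableSet] at key
    rw [zero_apply, ← neg_eq_zero, ← integral_neg, ← key]
    refine integral_congr_ae (Eventually.of_forall fun y => ?_)
    by_cases hy : y ∈ Ω <;>
      simp [hg, hy, L, ContinuousLinearMap.precompL_apply, mul_comm]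
  have hcst : ∀ k, ∀ x ∈ U k, ∀ y ∈ U k,
      ((φ k).normed μ ⋆[L, μ] g) x = ((φ k).normed μ ⋆[L, μ] g) y := fun k x hx y hy =>
    (hU k).is_const_of_fderiv_eq_zero (hUc k)
      (fun z _ => (hder k z).differentiableAt.differentiableWithinAt) (hzero k) hx hy
  -- If the mollifications converge at no point of `Ω`, then `Ω` is null and any constant serves.
  by_cases h : ∃ x₀ ∈ Ω, Tendsto (fun k => ((φ k).normed μ ⋆[L, μ] g) x₀) atTop (𝓝 (g x₀))
  · obtain ⟨x₀, hx₀, hl₀⟩ := h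
    refine ⟨g x₀, ?_⟩
    rw [Filter.EventuallyEq, ae_restrict_iff' hΩ.measurableSet]
    filter_upwards [hlim] with x hx hxΩ
    rw [show f x = g x by simp [hg, hxΩ]]
    refine tendsto_nhds_unique hx (hl₀.congr' ?_)
    filter_upwards [hex x hxΩ, hex x₀ hx₀] with k h1 h2
    exact hcst k x₀ h2 x h1
  · refine ⟨0, ?_⟩
    rw [Filter.EventuallyEq, ae_restrict_iff' hΩ.measurableSet]
    filter_upwards [hlim] with x hx hxΩ
    exact absurd ⟨x, hxΩ, hx⟩ h

/-! ### Polar coordinates -/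

section Polar

variable {E : Type*} [NormedAddCommGroup E] [NormedSpace ℝ E]
  [FiniteDimensional ℝ E] [MeasurableSpace E] [BorelSpace E] (μ : Measure E) [μ.IsAddHaarMeasure]

/-- Integrability of an integrable function in polar coordinates. -/
theorem integrable_polar {f : E → ℝ} (hf : Integrable f μ) :
    Integrable (fun p : Metric.sphere (0 : E) 1 × Ioi (0 : ℝ) => f (p.2.1 • p.1.1))
      (μ.toSphere.prod (Measure.volumeIoiPow (Module.finrank ℝ E - 1))) := by
  rw [← (μ.measurePreserving_homeomorphUnitSphereProd).integrable_comp_emb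
    (Homeomorph.measurableEmbedding _)]
  have h1 : Integrable (fun x : ({(0)}ᶜ : Set E) => f x) (μ.comap (↑)) :=
    (integrableOn_iff_comap_subtypeVal (measurableSet_singleton _).compl).1 hf.integrableOn
  refine h1.congr (Eventually.of_forall fun x => ?_)
  have hx : ‖(x : E)‖ ≠ 0 := norm_ne_zero_iff.2 x.2
  simp [smul_smul, hx]

theorem integrable_volumeIoiPow_iff (d : ℕ) {g : ℝ → ℝ} :
    Integrable (fun r : Ioi (0 : ℝ) => g r) (Measure.volumeIoiPow d) ↔
      IntegrableOn (fun r => r ^ d * g r) (Ioi 0) := by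
  rw [integrableOn_iff_comap_subtypeVal measurableSet_Ioi, Measure.volumeIoiPow,
    integrable_withDensity_iff_integrable_smul' (by fun_prop) (by simp)]
  refine integrable_congr (Eventually.of_forall ?_)
  rintro ⟨x, hx : 0 < x⟩
  simp (disch := positivity) [ENNReal.toReal_ofReal]

theorem integral_volumeIoiPow (d : ℕ) (g : ℝ → ℝ) :
    ∫ r : Ioi (0 : ℝ), g r ∂(Measure.volumeIoiPow d) = ∫ r in Ioi (0 : ℝ), r ^ d * g r := by
  simp only [Measure.volumeIoiPow, ENNReal.ofReal]
  rw [integral_withDensity_eq_integral_smul,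
    integral_subtype_comap measurableSet_Ioi fun a ↦ Real.toNNReal (a ^ d) • g a,
    setIntegral_congr_fun measurableSet_Ioi fun x hx ↦ ?_]
  · rw [NNReal.smul_def, Real.coe_toNNReal _ (pow_nonneg hx.out.le _), smul_eq_mul]
  · exact (measurable_subtype_coe.pow_const _).real_toNNReal

theorem integrableOn_polar {f : E → ℝ} (hf : Integrable f μ) :
    IntegrableOn (fun r : ℝ => r ^ (Module.finrank ℝ E - 1) * ∫ y, f (r • y.1) ∂μ.toSphere)
      (Ioi 0) := by
  rw [← integrable_volumeIoiPow_iff]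
  exact (integrable_polar μ hf).integral_prod_right

/-- Integration in polar coordinates. -/
theorem integral_polar [Nontrivial E] {f : E → ℝ} (hf : Integrable f μ) :
    ∫ x, f x ∂μ =
      ∫ r in Ioi (0 : ℝ), r ^ (Module.finrank ℝ E - 1) * ∫ y, f (r • y.1) ∂μ.toSphere := by
  have h := (μ.measurePreserving_homeomorphUnitSphereProd).integral_comp
    (Homeomorph.measurableEmbedding _)
    (fun p : Metric.sphere (0 : E) 1 × Ioi (0 : ℝ) => f (p.2.1 • p.1.1))
  have h' := integral_volumeIoiPow (Module.finrank ℝ E - 1) fun r => ∫ y, f (r • y.1) ∂μ.toSphere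
  -- The origin, where polar coordinates break down, is a null set since `E` is nontrivial.
  have h₀ : ∫ x, f x ∂μ = ∫ x : ({(0)}ᶜ : Set E), f x ∂(μ.comap (↑)) := by
    rw [integral_subtype_comap (measurableSet_singleton _).compl f, restrict_compl_singleton]
  rw [← h', ← integral_prod_symm _ (integrable_polar μ hf), ← h, h₀]
  refine integral_congr_ae (Eventually.of_forall fun x => ?_)
  have hx : ‖(x : E)‖ ≠ 0 := norm_ne_zero_iff.2 x.2
  simp [smul_smul, hx]

end Polar

/-! ### Geometry of the annulus -/

variable {n : ℕ} {a : ℝ}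

theorem isOpen_annulus : IsOpen (annulus n a) :=
  (isOpen_lt continuous_const continuous_norm).inter (isOpen_lt continuous_norm continuous_const)

theorem isCompact_closedAnnulus : IsCompact (closedAnnulus n a) := by
  refine (isCompact_closedBall (0 : Rn n) 1).of_isClosed_subset
    ((isClosed_le continuous_const continuous_norm).inter
      (isClosed_le continuous_norm continuous_const)) fun x hx => ?_
  simpa using hx.2

theorem annulus_subset_closedAnnulus : annulus n a ⊆ closedAnnulus n a :=
  fun _ hx => ⟨hx.1.le, hx.2.le⟩

theorem annulusBoundary_subset (ha₁ : a < 1) : annulusBoundary n a ⊆ closedAnnulus n a := by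
  rintro x (h | h)
  · exact ⟨h.ge, h.le.trans ha₁.le⟩
  · exact ⟨ha₁.le.trans h.ge, h.le⟩

theorem volume_annulus_lt_top : volume (annulus n a) < ⊤ :=
  (measure_mono annulus_subset_closedAnnulus).trans_lt isCompact_closedAnnulus.measure_lt_top

instance : IsFiniteMeasure (volume.restrict (annulus n a)) :=
  ⟨by simpa using volume_annulus_lt_top⟩

theorem annulus_nonempty (hn : 2 ≤ n) (ha₀ : 0 < a) (ha₁ : a < 1) : (annulus n a).Nonempty := by
  refine ⟨EuclideanSpace.single ⟨0, by omega⟩ ((a + 1) / 2), ?_, ?_⟩ <;>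
  · rw [PiLp.norm_single, Real.norm_of_nonneg (by linarith)]
    linarith

theorem volume_annulus_pos (hn : 2 ≤ n) (ha₀ : 0 < a) (ha₁ : a < 1) :
    0 < volume (annulus n a) :=
  isOpen_annulus.measure_pos _ (annulus_nonempty hn ha₀ ha₁)

/-- Spherical shells are connected in dimension at least two. -/
theorem isPreconnected_shell (hn : 2 ≤ n) {s t : ℝ} (hs : 0 ≤ s) :
    IsPreconnected {x : Rn n | s < ‖x‖ ∧ ‖x‖ < t} := by
  have hr : 1 < Module.rank ℝ (Rn n) := by
    rw [rank_eq_card_basis (EuclideanSpace.basisFun (Fin n) ℝ).toBasis]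
    simp only [Fintype.card_fin]
    exact_mod_cast (by omega : 1 < n)
  -- The shell is the image of an interval times the unit sphere under `(r, y) ↦ r • y`; the sphere
  -- is connected because the dimension exceeds one.
  have h := (isPreconnected_Ioo (a := s) (b := t)).prod
    (isPreconnected_sphere hr (0 : Rn n) 1)
  convert h.image (fun p : ℝ × Rn n => p.1 • p.2) (by fun_prop) using 1
  ext x
  simp only [mem_ofPred_eq, mem_image, Set.mem_prod, mem_Ioo, mem_sphere_iff_norm, sub_zero,
    Prod.exists]
  constructor
  · rintro ⟨h1, h2⟩
    have hx : ‖x‖ ≠ 0 := by linarith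
    exact ⟨‖x‖, ‖x‖⁻¹ • x, ⟨⟨h1, h2⟩, by simp [norm_smul, hx]⟩, by simp [smul_smul, hx]⟩
  · rintro ⟨r, y, ⟨⟨h1, h2⟩, hy⟩, rfl⟩
    rw [norm_smul, hy, Real.norm_of_nonneg (by linarith), mul_one]
    exact ⟨h1, h2⟩

theorem isPreconnected_annulus (hn : 2 ≤ n) (ha₀ : 0 < a) : IsPreconnected (annulus n a) :=
  isPreconnected_shell hn ha₀.le

/-- Every point of the closed annulus lies in a ball of radius `(1 - a) / 2` inside it. -/
theorem exists_closedBall_subset_closedAnnulus (ha₀ : 0 < a) {x : Rn n}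
    (hx : x ∈ closedAnnulus n a) :
    ∃ y : Rn n, x ∈ Metric.closedBall y ((1 - a) / 2) ∧
      Metric.closedBall y ((1 - a) / 2) ⊆ closedAnnulus n a ∧
      Metric.ball y ((1 - a) / 2) ⊆ annulus n a := by
  have h0 : 0 < ‖x‖ := ha₀.trans_le hx.1
  have hy : ‖((1 + a) / 2 / ‖x‖) • x‖ = (1 + a) / 2 := by
    rw [norm_smul, Real.norm_of_nonneg (by positivity)]
    field_simp
  -- The centre is the radial projection of `x` to the middle sphere, of radius `(1 + a) / 2`; the
  -- ball's radius is half the thickness of the annulus.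
  refine ⟨((1 + a) / 2 / ‖x‖) • x, ?_, ?_, ?_⟩
  · rw [Metric.mem_closedBall, dist_eq_norm]
    have : x - ((1 + a) / 2 / ‖x‖) • x = (1 - (1 + a) / 2 / ‖x‖) • x := by module
    rw [this, norm_smul, Real.norm_eq_abs, ← abs_of_pos h0, ← abs_mul, abs_of_pos h0, sub_mul,
      div_mul_cancel₀ _ h0.ne', abs_le]
    constructor <;> linarith [hx.1, hx.2]
  · intro z hz
    rw [Metric.mem_closedBall, dist_eq_norm] at hz
    have h1 := abs_norm_sub_norm_le z (((1 + a) / 2 / ‖x‖) • x)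
    rw [hy] at h1
    have h2 := abs_le.1 (h1.trans hz)
    constructor <;> linarith [h2.1, h2.2]
  · intro z hz
    rw [Metric.mem_ball, dist_eq_norm] at hz
    have h1 := abs_norm_sub_norm_le z (((1 + a) / 2 / ‖x‖) • x)
    rw [hy] at h1
    have h2 := abs_lt.1 (h1.trans_lt hz)
    constructor <;> linarith [h2.1, h2.2]

/-- The closed annulus is not convex, but each of its points lies in a closed ball contained in it,
and a ball is convex with interior. This gives meaning to derivatives within the closed annulus at
boundary points. -/
theorem uniqueDiffOn_closedAnnulus (ha₀ : 0 < a) (ha₁ : a < 1) :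
    UniqueDiffOn ℝ (closedAnnulus n a) := by
  intro x hx
  obtain ⟨y, hxy, hy, -⟩ := exists_closedBall_subset_closedAnnulus ha₀ hx
  refine (uniqueDiffWithinAt_convex (convex_closedBall y _) ?_ (subset_closure hxy)).mono hy
  exact ⟨y, Metric.ball_subset_interior_closedBall (Metric.mem_ball_self (by linarith))⟩

theorem closedAnnulus_mem_nhds {x : Rn n} (hx : x ∈ annulus n a) : closedAnnulus n a ∈ 𝓝 x :=
  mem_of_superset (isOpen_annulus.mem_nhds hx) annulus_subset_closedAnnulus

theorem closedAnnulus_subset_closure (ha₀ : 0 < a) (ha₁ : a < 1) :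
    closedAnnulus n a ⊆ closure (annulus n a) := by
  intro x hx
  obtain ⟨y, hxy, -, hy⟩ := exists_closedBall_subset_closedAnnulus ha₀ hx
  have h0 : (1 - a) / 2 ≠ 0 := by linarith
  rw [← closure_ball y h0] at hxy
  exact closure_mono hy hxy

/-! ### Weak derivatives on the annulus and on an interval -/

theorem clm_apply_eq_sum (l : Rn n →L[ℝ] ℝ) (v : Rn n) :
    l v = ∑ i, v i * l (EuclideanSpace.single i 1) := by
  conv_lhs => rw [← (EuclideanSpace.basisFun (Fin n) ℝ).sum_repr v]
  simp

/-- A function on the annulus with vanishing weak gradient is a.e. constant. -/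
theorem ae_const_of_weak_partial_eq_zero (hn : 2 ≤ n) (ha₀ : 0 < a) {u : Rn n → ℝ}
    (hu : IntegrableOn u (annulus n a))
    (hw : ∀ i, ∀ φ : Rn n → ℝ, ContDiff ℝ ∞ φ → HasCompactSupport φ → tsupport φ ⊆ annulus n a →
      ∫ x in annulus n a, u x * partialDeriv i φ x = 0) :
    ∃ c : ℝ, u =ᵐ[volume.restrict (annulus n a)] fun _ => c := by
  refine ae_const_of_weak_fderiv_eq_zero volume isOpen_annulus hu ?_
    -- Shells shrunk by `1 / (k + 1)` at each end, with half of that as mollification radius; those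
    -- for small `k` may be empty, which is harmless.
    (U := fun k : ℕ => {x : Rn n | a + 1 / ((k : ℝ) + 1) < ‖x‖ ∧ ‖x‖ < 1 - 1 / ((k : ℝ) + 1)})
    (δ := fun k : ℕ => 1 / ((k : ℝ) + 1) / 2) (fun k => by positivity) ?_ ?_ ?_ ?_ ?_
  · intro φ hφ hc hs v
    simp only [clm_apply_eq_sum _ v, Finset.mul_sum]
    rw [integral_finsetSum]
    · refine Finset.sum_eq_zero fun i _ => ?_
      rw [← mul_zero (v i), ← hw i φ hφ hc hs, ← integral_const_mul]
      congr 1 with x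
      simp only [partialDeriv]
      ring
    · intro i _
      have hcont : Continuous (partialDeriv i φ) :=
        (hφ.continuous_fderiv (by simp)).clm_apply continuous_const
      have hsup : HasCompactSupport (partialDeriv i φ) := hc.fderiv_apply ℝ _
      obtain ⟨C, hC⟩ := hsup.exists_bound_of_continuous hcont
      refine hu.mul_bdd (c := ‖v i‖ * C) (by fun_prop) (Eventually.of_forall fun x => ?_)
      rw [norm_mul]
      gcongr
      exact hC x
  · have := (tendsto_one_div_add_atTop_nhds_zero_nat (𝕜 := ℝ)).div_const 2
    simpa using this
  · exact fun k => (isOpen_lt continuous_const continuous_norm).inter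
      (isOpen_lt continuous_norm continuous_const)
  · exact fun k => isPreconnected_shell hn (by positivity)
  · intro k x hx z hz
    rw [Metric.mem_closedBall, dist_eq_norm] at hz
    have h2 := abs_le.1 ((abs_norm_sub_norm_le z x).trans hz)
    have h3 : 0 < 1 / ((k : ℝ) + 1) := by positivity
    constructor <;> linarith [h2.1, h2.2, hx.1, hx.2]
  · intro x hx
    have hl := tendsto_one_div_add_atTop_nhds_zero_nat (𝕜 := ℝ)
    filter_upwards [hl.eventually_lt_const (sub_pos.2 hx.1),
      hl.eventually_lt_const (sub_pos.2 hx.2)] with k h1 h2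
    constructor <;> linarith

/-- The fundamental theorem of calculus for weak derivatives. -/
theorem integral_eq_sub_of_weak_deriv {a b : ℝ} (hab : a < b) {G A : ℝ → ℝ}
    (hG : ContinuousOn G (Icc a b)) (hA : IntervalIntegrable A volume a b)
    (hAc : ContinuousOn A (Ioo a b))
    (hw : ∀ η : ℝ → ℝ, ContDiff ℝ ∞ η → HasCompactSupport η → tsupport η ⊆ Ioo a b →
      ∫ x in a..b, η x * A x = - ∫ x in a..b, deriv η x * G x) :
    ∫ x in a..b, A x = G b - G a := by
  have hH : ContinuousOn (fun t => ∫ x in a..t, A x) (Icc a b) := by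
    have := intervalIntegral.continuousOn_primitive_interval' hA (left_mem_uIcc)
    rwa [uIcc_of_le hab.le] at this
  have hH' : ∀ t ∈ Ioo a b, HasDerivAt (fun t => ∫ x in a..t, A x) (A t) t := by
    intro t ht
    refine intervalIntegral.integral_hasDerivAt_right
      (hA.mono_set (uIcc_subset_uIcc left_mem_uIcc (by
        rw [uIcc_of_le hab.le]; exact ⟨ht.1.le, ht.2.le⟩)))
      (hAc.stronglyMeasurableAtFilter isOpen_Ioo t ht) (hAc.continuousAt (isOpen_Ioo.mem_nhds ht))
  have hGH : ContinuousOn (fun t => G t - ∫ x in a..t, A x) (Icc a b) := hG.sub hH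
  -- `G` minus the primitive of `A` has zero weak derivative, by parts. It is therefore a.e.
  -- constant, and continuity extends this to the endpoints, where the values are compared.
  have hconst : ∃ c : ℝ, (fun t => G t - ∫ x in a..t, A x) =ᵐ[volume.restrict (Ioo a b)]
      fun _ => c := by
    refine ae_const_of_weak_fderiv_eq_zero volume isOpen_Ioo
      (hGH.integrableOn_Icc.mono_set Ioo_subset_Icc_self) ?_
      (U := fun k : ℕ => Ioo (a + 1 / ((k : ℝ) + 1)) (b - 1 / ((k : ℝ) + 1)))
      (δ := fun k : ℕ => 1 / ((k : ℝ) + 1) / 2) (fun k => by positivity) ?_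
      (fun k => isOpen_Ioo) (fun k => isPreconnected_Ioo) ?_ ?_
    · intro η hη hc hs v
      have hη' : Continuous (deriv η) := hη.continuous_deriv (by simp)
      have e : ∀ x, (G x - ∫ y in a..x, A y) * fderiv ℝ η x v
          = v * (deriv η x * G x - (∫ y in a..x, A y) * deriv η x) := by
        intro x
        rw [show v = v • (1 : ℝ) by simp, map_smul, fderiv_apply_one_eq_deriv]
        simp only [smul_eq_mul]
        ring
      have hz : ∀ x, x ∉ Ioo a b → η x = 0 := fun x hx => by
        by_contra h
        exact hx (hs (subset_tsupport _ h))
      have parts := intervalIntegral.integral_mul_deriv_eq_deriv_mul_of_hasDerivAt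
        (a := a) (b := b) (u := fun t => ∫ x in a..t, A x) (v := η) (u' := A) (v' := deriv η)
        (by rwa [uIcc_of_le hab.le]) hη.continuous.continuousOn
        (by rw [min_eq_left hab.le, max_eq_right hab.le]; exact hH')
        (fun x _ => (hη.differentiable (by simp) x).hasDerivAt) hA
        (hη'.intervalIntegrable _ _)
      rw [hz a (by simp), hz b (by simp)] at parts
      simp only [e]
      rw [← integral_Ioc_eq_integral_Ioo, ← intervalIntegral.integral_of_le hab.le,
        intervalIntegral.integral_const_mul, intervalIntegral.integral_sub, parts]
      · have := hw η hη hc hs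
        simp only [mul_comm (A _) (η _), this]
        ring
      · refine ContinuousOn.intervalIntegrable ?_
        rw [uIcc_of_le hab.le]
        exact hη'.continuousOn.mul hG
      · refine ContinuousOn.intervalIntegrable ?_
        rw [uIcc_of_le hab.le]
        exact hH.mul hη'.continuousOn
    · have := (tendsto_one_div_add_atTop_nhds_zero_nat (𝕜 := ℝ)).div_const 2
      simpa using this
    · intro k x hx z hz
      rw [Metric.mem_closedBall, Real.dist_eq] at hz
      have h2 := abs_le.1 hz
      have h3 : 0 < 1 / ((k : ℝ) + 1) := by positivity
      constructor <;> linarith [h2.1, h2.2, hx.1, hx.2]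
    · intro x hx
      have hl := tendsto_one_div_add_atTop_nhds_zero_nat (𝕜 := ℝ)
      filter_upwards [hl.eventually_lt_const (sub_pos.2 hx.1),
        hl.eventually_lt_const (sub_pos.2 hx.2)] with k h1 h2
      constructor <;> linarith
  obtain ⟨c, hc⟩ := hconst
  rw [Measure.restrict_congr_set Ioo_ae_eq_Icc] at hc
  have h := Measure.eqOn_Icc_of_ae_eq volume hab.ne hc hGH continuousOn_const
  have h1 := h (left_mem_Icc.2 hab.le)
  have h2 := h (right_mem_Icc.2 hab.le)
  simp only [intervalIntegral.integral_same] at h1 h2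
  linarith

/-! ### Integration over the annulus and its spheres -/

theorem nontrivial_Rn (hn : 2 ≤ n) : Nontrivial (Rn n) := by
  have : Nonempty (Fin n) := ⟨⟨0, by omega⟩⟩
  infer_instance

theorem smul_sphere_mem_annulus_iff {r : ℝ} (hr : 0 < r) (y : Metric.sphere (0 : Rn n) 1) :
    r • y.1 ∈ annulus n a ↔ r ∈ Ioo a 1 := by
  simp [annulus, norm_smul, abs_of_pos hr]

theorem smul_sphere_mem_closedAnnulus {r : ℝ} (ha₀ : 0 < a) (hr : r ∈ Icc a 1)
    (y : Metric.sphere (0 : Rn n) 1) : r • y.1 ∈ closedAnnulus n a := by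
  simpa [closedAnnulus, norm_smul, abs_of_pos (ha₀.trans_le hr.1)] using hr

/-- Integration over the annulus in polar coordinates. -/
theorem integral_annulus_polar (hn : 2 ≤ n) (ha₀ : 0 < a) (ha₁ : a < 1) {h : Rn n → ℝ}
    (hh : IntegrableOn h (annulus n a)) :
    IntervalIntegrable (fun r : ℝ => r ^ (n - 1) *
        ∫ y, h (r • y.1) ∂(volume : Measure (Rn n)).toSphere) volume a 1 ∧
      ∫ x in annulus n a, h x = ∫ r in a..1, r ^ (n - 1) *
        ∫ y, h (r • y.1) ∂(volume : Measure (Rn n)).toSphere := by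
  have := nontrivial_Rn hn
  have hi := (integrable_indicator_iff isOpen_annulus.measurableSet).2 hh
  have e : ∀ r ∈ Ioi (0 : ℝ), r ^ (n - 1) *
      ∫ y, (annulus n a).indicator h (r • y.1) ∂(volume : Measure (Rn n)).toSphere =
      (Ioo a 1).indicator (fun r : ℝ => r ^ (n - 1) *
        ∫ y, h (r • y.1) ∂(volume : Measure (Rn n)).toSphere) r := by
    intro r hr
    by_cases hr' : r ∈ Ioo a 1
    · simp only [indicator, smul_sphere_mem_annulus_iff hr, hr', if_true]
    · simp only [indicator, smul_sphere_mem_annulus_iff hr, hr', if_false, integral_zero, mul_zero]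
  have h1 := integrableOn_polar volume hi
  have h2 := integral_polar volume hi
  rw [finrank_euclideanSpace_fin] at h1 h2
  have hsub : Ioo a 1 ⊆ Ioi 0 := fun r hr => ha₀.trans hr.1
  rw [integrableOn_congr_fun e measurableSet_Ioi, integrableOn_indicator_iff measurableSet_Ioo,
    inter_eq_left.2 hsub] at h1
  rw [setIntegral_congr_fun measurableSet_Ioi e, setIntegral_indicator measurableSet_Ioo,
    inter_eq_right.2 hsub, integral_indicator isOpen_annulus.measurableSet] at h2
  refine ⟨?_, ?_⟩
  · rwa [intervalIntegrable_iff_integrableOn_Ioo_of_le ha₁.le]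
  · rw [h2, intervalIntegral.integral_of_le ha₁.le, integral_Ioc_eq_integral_Ioo]

/-- Compactness of the sphere gives continuity in the parameter. The weight `k` serves both the flux
(`k y = y i`) and the spherical integral of the divergence (`k = 1`). -/
theorem continuousOn_integral_sphere {I : Set ℝ} {K : Set (Rn n)} {h : Rn n → ℝ}
    {k : Rn n → ℝ} (hh : ContinuousOn h K) (hk : Continuous k)
    (hI : ∀ r ∈ I, ∀ y : Metric.sphere (0 : Rn n) 1, r • y.1 ∈ K) :
    ContinuousOn (fun r : ℝ => ∫ y, h (r • y.1) * k y.1 ∂(volume : Measure (Rn n)).toSphere)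
      I := by
  refine continuousOn_integral_of_compact_support (k := univ) isCompact_univ ?_ (by simp)
  refine ContinuousOn.mul (hh.comp (by fun_prop) ?_) (by fun_prop)
  rintro ⟨r, y⟩ ⟨hr, -⟩
  exact hI r hr y

theorem measurableEmbedding_smul_sphere {r : ℝ} (hr : r ≠ 0) :
    MeasurableEmbedding (fun y : Metric.sphere (0 : Rn n) 1 => r • y.1) :=
  ((Homeomorph.smulOfNeZero r hr).measurableEmbedding).comp
    (MeasurableEmbedding.subtype_coe Metric.isClosed_sphere.measurableSet)

theorem integrable_sphereMeasure {r : ℝ} (hr : 0 < r) {g : Rn n → ℝ}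
    (hg : Integrable (fun y => g (r • y.1)) (volume : Measure (Rn n)).toSphere) :
    Integrable g (sphereMeasure n r) := by
  refine Integrable.smul_measure ?_ ENNReal.ofReal_ne_top
  rw [(measurableEmbedding_smul_sphere hr.ne').integrable_map_iff]
  exact hg

theorem integral_sphereMeasure {r : ℝ} (hr : 0 < r) (g : Rn n → ℝ) :
    ∫ x, g x ∂(sphereMeasure n r) =
      r ^ (n - 1) * ∫ y, g (r • y.1) ∂(volume : Measure (Rn n)).toSphere := by
  rw [sphereMeasure, integral_smul_measure,
    (measurableEmbedding_smul_sphere hr.ne').integral_map, ENNReal.toReal_ofReal (by positivity),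
    smul_eq_mul]

/-! ### The divergence theorem -/

theorem continuous_mul_of_tsupport_subset {Ω : Set (Rn n)} (hΩ : IsOpen Ω) {φ f : Rn n → ℝ}
    (hφ : Continuous φ) (hs : tsupport φ ⊆ Ω) (hf : ContinuousOn f Ω) :
    Continuous fun x => φ x * f x := by
  refine continuous_of_tsupport fun x hx => ?_
  have hx' : x ∈ Ω := hs (tsupport_mul_subset_left hx)
  exact hφ.continuousAt.mul (hf.continuousAt (hΩ.mem_nhds hx'))

theorem setIntegral_mul_eq_integral {Ω : Set (Rn n)} {φ : Rn n → ℝ} (f : Rn n → ℝ)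
    (hs : tsupport φ ⊆ Ω) : ∫ x in Ω, φ x * f x = ∫ x, φ x * f x := by
  refine setIntegral_eq_integral_of_forall_compl_eq_zero fun x hx => ?_
  rw [image_eq_zero_of_notMem_tsupport (fun h => hx (hs h)), zero_mul]

/-- Integration by parts against a compactly supported function. -/
theorem integral_mul_partialDeriv {Ω : Set (Rn n)} (hΩ : IsOpen Ω) {φ f : Rn n → ℝ}
    (hφ : ContDiff ℝ 1 φ) (hc : HasCompactSupport φ) (hs : tsupport φ ⊆ Ω)
    (hf : ContDiffOn ℝ 1 f Ω) (i : Fin n) :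
    IntegrableOn (fun x => φ x * partialDeriv i f x) Ω ∧
    IntegrableOn (fun x => partialDeriv i φ x * f x) Ω ∧
    ∫ x in Ω, φ x * partialDeriv i f x = - ∫ x in Ω, partialDeriv i φ x * f x := by
  have hs' : tsupport (partialDeriv i φ) ⊆ Ω :=
    (tsupport_fderiv_apply_subset ℝ _).trans hs
  have hc' : HasCompactSupport (partialDeriv i φ) := hc.fderiv_apply ℝ _
  have hφ' : Continuous (partialDeriv i φ) :=
    (hφ.continuous_fderiv (by simp)).clm_apply continuous_const
  have hf' : ContinuousOn (partialDeriv i f) Ω :=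
    (hf.continuousOn_fderiv_of_isOpen hΩ le_rfl).clm_apply continuousOn_const
  have i1 : Integrable fun x => φ x * partialDeriv i f x :=
    (continuous_mul_of_tsupport_subset hΩ hφ.continuous hs hf').integrable_of_hasCompactSupport
      hc.mul_right
  have i2 : Integrable fun x => partialDeriv i φ x * f x :=
    (continuous_mul_of_tsupport_subset hΩ hφ' hs' hf.continuousOn).integrable_of_hasCompactSupport
      hc'.mul_right
  have i3 : Integrable fun x => φ x * f x :=
    (continuous_mul_of_tsupport_subset hΩ hφ.continuous hs
      hf.continuousOn).integrable_of_hasCompactSupport hc.mul_right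
  refine ⟨i1.integrableOn, i2.integrableOn, ?_⟩
  rw [setIntegral_mul_eq_integral _ hs, setIntegral_mul_eq_integral _ hs']
  exact integral_mul_fderiv_eq_neg_fderiv_mul_of_integrable i2 i1 i3
    (fun x _ => hφ.differentiable (by simp) x)
    (fun x hx => (hf.differentiableOn (by simp) x (hs hx)).differentiableAt
      (hΩ.mem_nhds (hs hx)))

/-- The classical divergence. -/
def divergence (F : Fin n → Rn n → ℝ) (x : Rn n) : ℝ := ∑ i, partialDeriv i (F i) x

/-- The norm is not smooth at the origin, but `η` vanishes on radii below `a`. -/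
theorem contDiff_comp_norm {η : ℝ → ℝ} (ha₀ : 0 < a) (hη : ContDiff ℝ ∞ η)
    (hs : tsupport η ⊆ Ioo a 1) : ContDiff ℝ ∞ fun x : Rn n => η ‖x‖ := by
  rw [contDiff_iff_contDiffAt]
  intro x
  by_cases hx : ‖x‖ < a
  · have : (fun x : Rn n => η ‖x‖) =ᶠ[𝓝 x] fun _ => 0 := by
      filter_upwards [(isOpen_lt continuous_norm continuous_const).mem_nhds hx] with z hz
      exact image_eq_zero_of_notMem_tsupport fun h => (hs h).1.not_gt hz
    exact contDiffAt_const.congr_of_eventuallyEq this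
  · have hx0 : x ≠ 0 := by
      rintro rfl
      simp [ha₀] at hx
    exact hη.contDiffAt.comp x (contDiffAt_norm ℝ hx0)

theorem tsupport_comp_norm_subset {η : ℝ → ℝ} (hs : tsupport η ⊆ Ioo a 1) :
    tsupport (fun x : Rn n => η ‖x‖) ⊆ annulus n a := by
  have h1 : tsupport (fun x : Rn n => η ‖x‖) ⊆ norm ⁻¹' tsupport η :=
    closure_minimal (fun x hx => subset_tsupport η hx)
      ((isClosed_tsupport η).preimage continuous_norm)
  exact fun x hx => hs (h1 hx)

theorem partialDeriv_comp_norm {η : ℝ → ℝ} (hη : ContDiff ℝ ∞ η) (i : Fin n) {x : Rn n}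
    (hx : x ≠ 0) : partialDeriv i (fun x : Rn n => η ‖x‖) x = deriv η ‖x‖ * (‖x‖⁻¹ * x i) := by
  have hN : HasFDerivAt (fun z : Rn n => ‖z‖) (fderiv ℝ (fun z : Rn n => ‖z‖) x) x :=
    ((contDiffAt_norm (n := 1) ℝ hx).differentiableAt (by simp)).hasFDerivAt
  -- The derivative of the norm is read off by differentiating `‖z‖ ^ 2` in two ways.
  have h1 : HasFDerivAt (fun z : Rn n => ‖z‖ ^ 2) _ x := hN.pow 2
  have h2 := h1.unique (hasStrictFDerivAt_norm_sq x).hasFDerivAt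
  have h3 : 2 * ‖x‖ * fderiv ℝ (fun z : Rn n => ‖z‖) x (EuclideanSpace.single i 1) = 2 * x i := by
    simpa [EuclideanSpace.inner_single_right] using
      DFunLike.congr_fun h2 (EuclideanSpace.single i 1)
  have h4 : HasFDerivAt (fun z : Rn n => η ‖z‖) _ x :=
    ((hη.differentiable (by simp) ‖x‖).hasDerivAt).comp_hasFDerivAt x hN
  have hx' : ‖x‖ ≠ 0 := norm_ne_zero_iff.2 hx
  rw [partialDeriv, h4.fderiv]
  simp only [FunLike.coe_smul, Pi.smul_apply, smul_eq_mul]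
  rw [show x i = ‖x‖ * fderiv ℝ (fun z : Rn n => ‖z‖) x (EuclideanSpace.single i 1) by linarith]
  field_simp

/-- The **divergence theorem** on the annulus. -/
theorem integral_divergence (hn : 2 ≤ n) (ha₀ : 0 < a) (ha₁ : a < 1) {F : Fin n → Rn n → ℝ}
    (hF : ∀ i, ContinuousOn (F i) (closedAnnulus n a))
    (hF' : ∀ i, ContDiffOn ℝ 1 (F i) (annulus n a))
    (hD : IntegrableOn (divergence F) (annulus n a)) :
    ∫ x in annulus n a, divergence F x =
      ∫ x, ∑ i, F i x * outwardNormal a x i ∂(boundaryMeasure n a) := by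
  set σ := (volume : Measure (Rn n)).toSphere
  -- `G r` is the flux of `F` through the sphere of radius `r`. As the normal points inwards on the
  -- inner sphere, the boundary integral is `G 1 - G a`.
  set G : ℝ → ℝ := fun r => r ^ (n - 1) * ∫ y, ∑ i, F i (r • y.1) * y.1 i ∂σ with hG
  obtain ⟨hA, hA'⟩ := integral_annulus_polar hn ha₀ ha₁ hD
  have hSc : ∀ r ∈ Icc a 1, ∀ i, Continuous fun y : Metric.sphere (0 : Rn n) 1 =>
      F i (r • y.1) * y.1 i := by
    intro r hr i
    refine Continuous.mul ?_ (by fun_prop)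
    exact (hF i).comp_continuous (by fun_prop) (smul_sphere_mem_closedAnnulus ha₀ hr)
  have hSi : ∀ r ∈ Icc a 1, ∀ i, Integrable (fun y : Metric.sphere (0 : Rn n) 1 =>
      F i (r • y.1) * y.1 i) σ := fun r hr i =>
    (hSc r hr i).integrable_of_hasCompactSupport (HasCompactSupport.of_compactSpace _)
  have hD' : ContinuousOn (divergence F) (annulus n a) := by
    unfold divergence
    refine continuousOn_finsetSum _ fun i _ => ?_
    exact ((hF' i).continuousOn_fderiv_of_isOpen isOpen_annulus le_rfl).clm_apply
      continuousOn_const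
  have hb : ∫ x, ∑ i, F i x * outwardNormal a x i ∂(boundaryMeasure n a) = G 1 - G a := by
    have e1 : ∀ y : Metric.sphere (0 : Rn n) 1,
        ∑ i, F i ((1 : ℝ) • y.1) * outwardNormal a ((1 : ℝ) • y.1) i =
          ∑ i, F i ((1 : ℝ) • y.1) * y.1 i := by
      intro y
      simp [outwardNormal, ha₁.ne']
    have e2 : ∀ y : Metric.sphere (0 : Rn n) 1,
        ∑ i, F i (a • y.1) * outwardNormal a (a • y.1) i = - ∑ i, F i (a • y.1) * y.1 i := by
      intro y
      have : ‖a • y.1‖ = a := by simp [norm_smul, abs_of_pos ha₀]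
      simp [outwardNormal, this, ha₀.ne']
    rw [boundaryMeasure, integral_add_measure, integral_sphereMeasure ha₀,
      integral_sphereMeasure one_pos]
    · simp only [e1, e2, integral_neg, hG]
      ring
    · refine integrable_sphereMeasure ha₀ ?_
      simp only [e2]
      exact (integrable_finsetSum _ fun i _ => hSi a ⟨le_rfl, ha₁.le⟩ i).neg
    · refine integrable_sphereMeasure one_pos ?_
      simp only [e1]
      exact integrable_finsetSum _ fun i _ => hSi 1 ⟨ha₁.le, le_rfl⟩ i
  rw [hb, hA']
  refine integral_eq_sub_of_weak_deriv ha₁ ?_ hA ?_ ?_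
  · refine ContinuousOn.mul (by fun_prop) ?_
    refine ContinuousOn.congr (f := fun r => ∑ i, ∫ y, F i (r • y.1) * y.1 i ∂σ) ?_
      fun r hr => integral_finsetSum _ fun i _ => hSi r hr i
    exact continuousOn_finsetSum _ fun i _ => continuousOn_integral_sphere (hF i)
      (k := fun y => y i) (by fun_prop) fun r hr => smul_sphere_mem_closedAnnulus ha₀ hr
  · refine ContinuousOn.mul (by fun_prop) ?_
    have := continuousOn_integral_sphere hD' (k := fun _ => 1) continuous_const
      (I := Ioo a 1) fun r hr y => (smul_sphere_mem_annulus_iff (ha₀.trans hr.1) y).2 hr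
    simpa using this
  -- Integration by parts against the radial function `η ‖x‖`, whose gradient at `r • y` is `η'(r)
  -- y`, yields the weak derivative of `G` after passing to polar coordinates.
  · intro η hη hc hs
    have hφ := contDiff_comp_norm (n := n) ha₀ hη hs
    have hφs := tsupport_comp_norm_subset (n := n) hs
    have hφc : HasCompactSupport fun x : Rn n => η ‖x‖ :=
      isCompact_closedAnnulus.of_isClosed_subset (isClosed_tsupport _)
        (hφs.trans annulus_subset_closedAnnulus)
    have hp := fun i => integral_mul_partialDeriv isOpen_annulus (hφ.of_le (by simp)) hφc hφs
      (hF' i) i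
    have w1 : ∫ x in annulus n a, η ‖x‖ * divergence F x =
        - ∫ x in annulus n a, ∑ i, partialDeriv i (fun x : Rn n => η ‖x‖) x * F i x := by
      simp only [divergence, Finset.mul_sum]
      rw [integral_finsetSum _ fun i _ => (hp i).1, integral_finsetSum _ fun i _ => (hp i).2.1,
        ← Finset.sum_neg_distrib]
      exact Finset.sum_congr rfl fun i _ => (hp i).2.2
    have l1 : IntegrableOn (fun x => η ‖x‖ * divergence F x) (annulus n a) := by
      simp only [divergence, Finset.mul_sum]
      exact integrable_finsetSum _ fun i _ => (hp i).1
    have l2 : IntegrableOn (fun x => ∑ i, partialDeriv i (fun x : Rn n => η ‖x‖) x * F i x)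
        (annulus n a) := integrable_finsetSum _ fun i _ => (hp i).2.1
    rw [(integral_annulus_polar hn ha₀ ha₁ l1).2, (integral_annulus_polar hn ha₀ ha₁ l2).2] at w1
    have hnorm : ∀ r ∈ uIcc a 1, ∀ y : Metric.sphere (0 : Rn n) 1, ‖r • y.1‖ = r := by
      intro r hr y
      rw [uIcc_of_le ha₁.le] at hr
      simp [norm_smul, abs_of_pos (ha₀.trans_le hr.1)]
    convert w1 using 1
    · refine intervalIntegral.integral_congr fun r hr => ?_
      simp only [hnorm r hr, integral_const_mul]
      ring
    · congr 1
      refine intervalIntegral.integral_congr fun r hr => ?_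
      have hr0 : 0 < r := by
        rw [uIcc_of_le ha₁.le] at hr
        exact ha₀.trans_le hr.1
      have e : ∀ y : Metric.sphere (0 : Rn n) 1,
          ∑ i, partialDeriv i (fun x : Rn n => η ‖x‖) (r • y.1) * F i (r • y.1) =
            deriv η r * ∑ i, F i (r • y.1) * y.1 i := by
        intro y
        rw [Finset.mul_sum]
        refine Finset.sum_congr rfl fun i _ => ?_
        rw [partialDeriv_comp_norm hη i (norm_pos_iff.1 (by rw [hnorm r hr y]; exact hr0)),
          hnorm r hr y]
        simp [hr0.ne']
        ring
      simp only [e, integral_const_mul, hG]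
      ring

/-! ### Traces and Green's identity -/

/-- The integral of a product is continuous on `L²`. -/
theorem tendsto_integral_mul_of_tendsto_eLpNorm {α : Type*} [MeasurableSpace α] {μ : Measure α}
    {f g : ℕ → α → ℝ} {F G : α → ℝ} (hf : ∀ k, MemLp (f k) 2 μ) (hg : ∀ k, MemLp (g k) 2 μ)
    (hF : MemLp F 2 μ) (hG : MemLp G 2 μ)
    (hfF : Tendsto (fun k => eLpNorm (fun x => f k x - F x) 2 μ) atTop (𝓝 0))
    (hgG : Tendsto (fun k => eLpNorm (fun x => g k x - G x) 2 μ) atTop (𝓝 0)) :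
    Tendsto (fun k => ∫ x, f k x * g k x ∂μ) atTop (𝓝 (∫ x, F x * G x ∂μ)) := by
  have e : ∀ {p q : α → ℝ} (hp : MemLp p 2 μ) (hq : MemLp q 2 μ),
      ⟪hp.toLp p, hq.toLp q⟫_ℝ = ∫ x, p x * q x ∂μ := by
    intro p q hp hq
    rw [L2.inner_def]
    refine integral_congr_ae ?_
    filter_upwards [hp.coeFn_toLp, hq.coeFn_toLp] with x h1 h2
    rw [h1, h2]
    simp [mul_comm]
  have l1 := (Lp.tendsto_Lp_iff_tendsto_eLpNorm'' f hf F hF).2 hfF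
  have l2 := (Lp.tendsto_Lp_iff_tendsto_eLpNorm'' g hg G hG).2 hgG
  have := l1.inner (𝕜 := ℝ) l2
  simpa only [e] using this

theorem ae_sphereMeasure {r : ℝ} (hr : 0 < r) : ∀ᵐ x ∂(sphereMeasure n r), ‖x‖ = r := by
  refine Measure.ae_smul_measure ?_ _
  rw [(measurableEmbedding_smul_sphere hr.ne').ae_map_iff]
  exact Eventually.of_forall fun y => by simp [norm_smul, abs_of_pos hr]

theorem ae_boundaryMeasure (ha₀ : 0 < a) :
    ∀ᵐ x ∂(boundaryMeasure n a), x ∈ annulusBoundary n a := by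
  rw [boundaryMeasure, ae_add_measure_iff]
  exact ⟨(ae_sphereMeasure ha₀).mono fun _ h => Or.inl h,
    (ae_sphereMeasure one_pos).mono fun _ h => Or.inr h⟩

instance (r : ℝ) : IsFiniteMeasure (sphereMeasure n r) := by
  unfold sphereMeasure
  exact Measure.smul_finite _ ENNReal.ofReal_ne_top

instance : IsFiniteMeasure (boundaryMeasure n a) := by
  unfold boundaryMeasure
  infer_instance

theorem memLp_annulus_of_continuous {f : Rn n → ℝ} (hf : Continuous f) :
    MemLp f 2 (volume.restrict (annulus n a)) := by
  obtain ⟨C, hC⟩ := (isCompact_closedAnnulus (n := n) (a := a)).exists_bound_of_continuousOn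
    hf.continuousOn
  refine MemLp.of_bound hf.aestronglyMeasurable C ?_
  filter_upwards [ae_restrict_mem isOpen_annulus.measurableSet] with x hx
  exact hC x (annulus_subset_closedAnnulus hx)

theorem memLp_boundaryMeasure_of_continuous (ha₀ : 0 < a) (ha₁ : a < 1) {f : Rn n → ℝ}
    (hf : Continuous f) : MemLp f 2 (boundaryMeasure n a) := by
  obtain ⟨C, hC⟩ := (isCompact_closedAnnulus (n := n) (a := a)).exists_bound_of_continuousOn
    hf.continuousOn
  refine MemLp.of_bound hf.aestronglyMeasurable C ?_
  filter_upwards [ae_boundaryMeasure ha₀] with x hx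
  exact hC x (annulusBoundary_subset ha₁ hx)

theorem measurable_outwardNormal : Measurable (outwardNormal a : Rn n → Rn n) := by
  refine Measurable.ite (measurableSet_eq_fun measurable_norm measurable_const) ?_ ?_ <;>
    fun_prop

theorem norm_outwardNormal_le (x : Rn n) : ‖outwardNormal a x‖ ≤ 1 := by
  have : ‖‖x‖⁻¹ • x‖ ≤ 1 := by
    rw [norm_smul, norm_inv, norm_norm]
    exact inv_mul_le_one
  unfold outwardNormal
  split_ifs <;> simpa using this

/-- The normal field jumps across the sphere of radius `a`, so measurability and boundedness replace
continuity. -/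
theorem memLp_normal_derivative (ha₀ : 0 < a) (ha₁ : a < 1) {φ : Rn n → ℝ}
    (hφ : ContDiff ℝ ∞ φ) :
    MemLp (fun x => fderiv ℝ φ x (outwardNormal a x)) 2 (boundaryMeasure n a) := by
  have hφ' : Continuous (fderiv ℝ φ) := hφ.continuous_fderiv (by simp)
  obtain ⟨C, hC⟩ := (isCompact_closedAnnulus (n := n) (a := a)).exists_bound_of_continuousOn
    hφ'.continuousOn
  refine MemLp.of_bound ?_ C ?_
  · exact (isBoundedBilinearMap_apply.continuous.measurable.comp
      (hφ'.measurable.prodMk measurable_outwardNormal)).aestronglyMeasurable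
  · filter_upwards [ae_boundaryMeasure ha₀] with x hx
    calc _ ≤ ‖fderiv ℝ φ x‖ * ‖outwardNormal a x‖ := ContinuousLinearMap.le_opNorm _ _
      _ ≤ C * 1 := mul_le_mul (hC x (annulusBoundary_subset ha₁ hx)) (norm_outwardNormal_le x)
          (norm_nonneg _) ((norm_nonneg _).trans (hC x (annulusBoundary_subset ha₁ hx)))
      _ = C := mul_one C

theorem contDiff_partialDeriv {φ : Rn n → ℝ} (hφ : ContDiff ℝ ∞ φ) (i : Fin n) :
    ContDiff ℝ ∞ (partialDeriv i φ) :=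
  (hφ.fderiv_right (m := ∞) (by simp)).clm_apply contDiff_const

theorem partialDeriv_mul {f g : Rn n → ℝ} {x : Rn n} (hf : DifferentiableAt ℝ f x)
    (hg : DifferentiableAt ℝ g x) (i : Fin n) :
    partialDeriv i (fun y => f y * g y) x = f x * partialDeriv i g x + g x * partialDeriv i f x := by
  simp [partialDeriv, fderiv_fun_mul hf hg]

/-- **Green's first identity** for smooth functions on the annulus. -/
theorem green_smooth (hn : 2 ≤ n) (ha₀ : 0 < a) (ha₁ : a < 1) {φ ψ : Rn n → ℝ}
    (hφ : ContDiff ℝ ∞ φ) (hψ : ContDiff ℝ ∞ ψ) :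
    (∑ i, ∫ x in annulus n a, partialDeriv i ψ x * partialDeriv i φ x) +
      ∑ i, ∫ x in annulus n a, ψ x * partialDeriv i (partialDeriv i φ) x =
    ∫ x, ψ x * fderiv ℝ φ x (outwardNormal a x) ∂(boundaryMeasure n a) := by
  have hFi : ∀ i, ContDiff ℝ ∞ fun x => ψ x * partialDeriv i φ x :=
    fun i => hψ.mul (contDiff_partialDeriv hφ i)
  have hdiv : ∀ x, divergence (fun i x => ψ x * partialDeriv i φ x) x =
      ∑ i, (partialDeriv i ψ x * partialDeriv i φ x + ψ x * partialDeriv i (partialDeriv i φ) x) := by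
    intro x
    refine Finset.sum_congr rfl fun i _ => ?_
    rw [partialDeriv_mul (hψ.differentiable (by simp) x)
      ((contDiff_partialDeriv hφ i).differentiable (by simp) x)]
    ring
  have i1 : ∀ i, Integrable (fun x => partialDeriv i ψ x * partialDeriv i φ x)
      (volume.restrict (annulus n a)) := fun i =>
    (memLp_annulus_of_continuous ((contDiff_partialDeriv hψ i).continuous.mul
      (contDiff_partialDeriv hφ i).continuous)).integrable (by norm_num)
  have i2 : ∀ i, Integrable (fun x => ψ x * partialDeriv i (partialDeriv i φ) x)
      (volume.restrict (annulus n a)) := fun i =>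
    (memLp_annulus_of_continuous (hψ.continuous.mul
      (contDiff_partialDeriv (contDiff_partialDeriv hφ i) i).continuous)).integrable (by norm_num)
  have i12 : ∀ i, Integrable (fun x => partialDeriv i ψ x * partialDeriv i φ x +
      ψ x * partialDeriv i (partialDeriv i φ) x) (volume.restrict (annulus n a)) :=
    fun i => (i1 i).add (i2 i)
  -- The field is `ψ ∇φ`.
  have key := integral_divergence hn ha₀ ha₁ (F := fun i x => ψ x * partialDeriv i φ x)
    (fun i => (hFi i).continuous.continuousOn)
    (fun i => ((hFi i).of_le (by simp)).contDiffOn) (by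
      simp only [funext hdiv]
      exact integrable_finsetSum _ fun i _ => i12 i)
  simp only [hdiv] at key
  rw [integral_finsetSum _ fun i _ => i12 i,
    Finset.sum_congr rfl fun i _ => integral_add (i1 i) (i2 i), Finset.sum_add_distrib] at key
  rw [key]
  congr 1 with x
  rw [clm_apply_eq_sum, Finset.mul_sum]
  exact Finset.sum_congr rfl fun i _ => by simp only [partialDeriv]; ring

theorem eLpNorm_sub_le_h2Dist (Ω : Set (Rn n)) (φ u : Rn n → ℝ) :
    eLpNorm (fun x => φ x - u x) 2 (volume.restrict Ω) ≤ h2Dist Ω φ u :=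
  le_self_add.trans le_self_add

theorem eLpNorm_partialDeriv_sub_le_h2Dist (Ω : Set (Rn n)) (φ u : Rn n → ℝ) (i : Fin n) :
    eLpNorm (fun x => partialDeriv i φ x - weakPartial Ω i u x) 2 (volume.restrict Ω) ≤
      h2Dist Ω φ u :=
  (Finset.single_le_sum (f := fun i => eLpNorm (fun x => partialDeriv i φ x - weakPartial Ω i u x) 2
    (volume.restrict Ω)) (fun _ _ => zero_le) (Finset.mem_univ i)).trans
    (le_add_self.trans le_self_add)

theorem eLpNorm_partialDeriv_partialDeriv_sub_le_h2Dist (Ω : Set (Rn n)) (φ u : Rn n → ℝ)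
    (i j : Fin n) :
    eLpNorm (fun x => partialDeriv j (partialDeriv i φ) x - weakPartial Ω j (weakPartial Ω i u) x) 2
      (volume.restrict Ω) ≤ h2Dist Ω φ u :=
  ((Finset.single_le_sum (f := fun j => eLpNorm (fun x => partialDeriv j (partialDeriv i φ) x -
    weakPartial Ω j (weakPartial Ω i u) x) 2 (volume.restrict Ω)) (fun _ _ => zero_le)
    (Finset.mem_univ j)).trans
    (Finset.single_le_sum (f := fun i => ∑ j, eLpNorm (fun x => partialDeriv j (partialDeriv i φ) x -
    weakPartial Ω j (weakPartial Ω i u) x) 2 (volume.restrict Ω)) (fun _ _ => zero_le)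
    (Finset.mem_univ i))).trans le_add_self

/-- **Green's first identity** for `u ∈ H²_*`: there is no boundary term. -/
theorem green_memH2Star (hn : 2 ≤ n) (ha₀ : 0 < a) (ha₁ : a < 1) {u g : Rn n → ℝ}
    (hu : MemH2Star a u) (hg : HasTrace a u g) :
    (∑ i, ∫ x in annulus n a, weakPartial (annulus n a) i u x * weakPartial (annulus n a) i u x) +
      ∫ x in annulus n a, u x * weakLaplacian (annulus n a) u x = 0 := by
  -- Two approximating sequences are needed: the normal derivatives of `φ k` tend to zero, while the
  -- boundary values of `ψ k` converge to `g`. Green's identity for the pair `φ k`, `ψ k` passes to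
  -- the limit in `L²`.
  obtain ⟨hH, -, φ, hφ, hφu, hφν⟩ := hu
  obtain ⟨hgL, ψ, hψ, hψu, hψg⟩ := hg
  have sq : ∀ {p : ℕ → ℝ≥0∞} {q : ℕ → ℝ≥0∞}, Tendsto q atTop (𝓝 0) → (∀ k, p k ≤ q k) →
      Tendsto p atTop (𝓝 0) := fun hq hpq =>
    tendsto_of_tendsto_of_tendsto_of_le_of_le tendsto_const_nhds hq (fun _ => zero_le) hpq
  have t1 := fun i => tendsto_integral_mul_of_tendsto_eLpNorm
    (fun k => memLp_annulus_of_continuous (a := a) (contDiff_partialDeriv (hψ k) i).continuous)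
    (fun k => memLp_annulus_of_continuous (a := a) (contDiff_partialDeriv (hφ k) i).continuous)
    (hH.memLp_first i) (hH.memLp_first i)
    (sq hψu fun k => eLpNorm_partialDeriv_sub_le_h2Dist _ _ _ i)
    (sq hφu fun k => eLpNorm_partialDeriv_sub_le_h2Dist _ _ _ i)
  have t2 := fun i => tendsto_integral_mul_of_tendsto_eLpNorm
    (fun k => memLp_annulus_of_continuous (a := a) (hψ k).continuous)
    (fun k => memLp_annulus_of_continuous (a := a)
      (contDiff_partialDeriv (contDiff_partialDeriv (hφ k) i) i).continuous)
    hH.memLp (hH.memLp_second i i)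
    (sq hψu fun k => eLpNorm_sub_le_h2Dist _ _ _)
    (sq hφu fun k => eLpNorm_partialDeriv_partialDeriv_sub_le_h2Dist _ _ _ i i)
  have t3 := tendsto_integral_mul_of_tendsto_eLpNorm
    (fun k => memLp_boundaryMeasure_of_continuous ha₀ ha₁ (hψ k).continuous)
    (fun k => memLp_normal_derivative ha₀ ha₁ (hφ k)) hgL MemLp.zero hψg hφν
  have t := (tendsto_finsetSum Finset.univ fun i _ => t1 i).add
    (tendsto_finsetSum Finset.univ fun i _ => t2 i)
  simp only [green_smooth hn ha₀ ha₁ (hφ _) (hψ _)] at t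
  have h := tendsto_nhds_unique t t3
  simp only [Pi.zero_apply, mul_zero, integral_zero] at h
  rw [← h]
  congr 1
  simp only [weakLaplacian, Finset.mul_sum]
  exact integral_finsetSum _ fun i _ => hH.memLp.integrable_mul (hH.memLp_second i i)

/-! ### Weak eigenfunctions -/

theorem memLp_weakLaplacian {u : Rn n → ℝ} (hu : MemH2 (annulus n a) u) :
    MemLp (weakLaplacian (annulus n a) u) 2 (volume.restrict (annulus n a)) :=
  memLp_finsetSum _ fun i _ => hu.memLp_second i i

/-- Weak eigenfunctions for `λ = 0` are constant. -/
theorem IsWeakEigenfunction.ae_eq_const (hn : 2 ≤ n) (ha₀ : 0 < a) (ha₁ : a < 1) {γ : ℝ}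
    {u : Rn n → ℝ} (hu : IsWeakEigenfunction a γ 0 u) :
    ∃ c : ℝ, c ≠ 0 ∧ u =ᵐ[volume.restrict (annulus n a)] fun _ => c := by
  obtain ⟨hH, hne, g, hg, hw⟩ := hu
  have h0 : bilapForm (annulus n a) u u = 0 := by
    rw [hw u g hH hg]
    simp
  have hsq : ∀ {f : Rn n → ℝ}, MemLp f 2 (volume.restrict (annulus n a)) →
      ∫ x in annulus n a, f x * f x = 0 → f =ᵐ[volume.restrict (annulus n a)] 0 := by
    intro f hf h
    have := (integral_eq_zero_iff_of_nonneg (fun x => mul_self_nonneg (f x))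
      (hf.integrable_mul hf)).1 h
    filter_upwards [this] with x hx
    exact mul_self_eq_zero.1 hx
  have hL := hsq (memLp_weakLaplacian hH.1) h0
  have hgreen := green_memH2Star hn ha₀ ha₁ hH hg
  have hz : ∫ x in annulus n a, u x * weakLaplacian (annulus n a) u x = 0 := by
    rw [← integral_zero (Rn n) ℝ (μ := volume.restrict (annulus n a))]
    refine integral_congr_ae ?_
    filter_upwards [hL] with x hx
    simp [hx]
  -- Only the sum of the integrals of the squared first derivatives is left, so each of them
  -- vanishes.
  rw [hz, add_zero, Finset.sum_eq_zero_iff_of_nonneg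
    fun i _ => integral_nonneg fun x => mul_self_nonneg _] at hgreen
  have hd := fun i => hsq (hH.1.memLp_first i) (hgreen i (Finset.mem_univ i))
  obtain ⟨c, hc⟩ := ae_const_of_weak_partial_eq_zero hn ha₀
    (hH.1.memLp.integrable (by norm_num)) (fun i φ hφ hcs hs => by
      rw [(hasWeakPartial_weakPartial (hH.1.exists_first i)).2.2 φ hφ hcs hs, neg_eq_zero,
        ← integral_zero (Rn n) ℝ (μ := volume.restrict (annulus n a))]
      refine integral_congr_ae ?_
      filter_upwards [hd i] with x hx
      simp [hx])
  refine ⟨c, ?_, hc⟩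
  rintro rfl
  exact hne hc

theorem partialDeriv_const (i : Fin n) (c : ℝ) : partialDeriv i (fun _ : Rn n => c) = fun _ => 0 := by
  ext x
  simp [partialDeriv]

theorem hasWeakPartial_of_ae_const {u : Rn n → ℝ} {c : ℝ}
    (hu : u =ᵐ[volume.restrict (annulus n a)] fun _ => c) (i : Fin n) :
    HasWeakPartial (annulus n a) i u 0 := by
  have hui : IntegrableOn u (annulus n a) := (integrable_const c).congr hu.symm
  refine ⟨hui.locallyIntegrableOn, IntegrableOn.locallyIntegrableOn integrableOn_zero, fun φ hφ hc hs => ?_⟩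
  have h := (integral_mul_partialDeriv isOpen_annulus (hφ.of_le (by simp)) hc hs
    (f := fun _ => c) contDiffOn_const i).2.2
  simp only [partialDeriv_const, mul_zero, integral_zero] at h
  simp only [Pi.zero_apply, zero_mul, integral_zero]
  rw [h, neg_neg]
  refine integral_congr_ae ?_
  filter_upwards [hu] with x hx
  rw [hx, mul_comm]

/-- `weakPartial` is an arbitrary choice, determined only up to null sets. With an a.e. hypothesis
the lemma can be applied to its own conclusion, with `c = 0`, to reach second derivatives. -/
theorem weakPartial_ae_zero {u : Rn n → ℝ} {c : ℝ}
    (hu : u =ᵐ[volume.restrict (annulus n a)] fun _ => c) (i : Fin n) :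
    weakPartial (annulus n a) i u =ᵐ[volume.restrict (annulus n a)] fun _ => 0 :=
  HasWeakPartial.ae_eq isOpen_annulus
    (hasWeakPartial_weakPartial ⟨0, hasWeakPartial_of_ae_const hu i⟩)
    (hasWeakPartial_of_ae_const hu i)

theorem memH2_of_ae_const {u : Rn n → ℝ} {c : ℝ}
    (hu : u =ᵐ[volume.restrict (annulus n a)] fun _ => c) : MemH2 (annulus n a) u where
  memLp := (memLp_congr_ae hu).2 (memLp_const c)
  exists_first i := ⟨0, hasWeakPartial_of_ae_const hu i⟩
  memLp_first i := (memLp_congr_ae (weakPartial_ae_zero hu i)).2 (memLp_const 0)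
  exists_second i j := ⟨0, hasWeakPartial_of_ae_const (weakPartial_ae_zero hu i) j⟩
  memLp_second i j :=
    (memLp_congr_ae (weakPartial_ae_zero (weakPartial_ae_zero hu i) j)).2 (memLp_const 0)

theorem h2Dist_const_eq_zero {u : Rn n → ℝ} {c : ℝ}
    (hu : u =ᵐ[volume.restrict (annulus n a)] fun _ => c) :
    h2Dist (annulus n a) (fun _ => c) u = 0 := by
  have e : ∀ {f : Rn n → ℝ} {d : ℝ}, f =ᵐ[volume.restrict (annulus n a)] (fun _ => d) →
      eLpNorm (fun x => d - f x) 2 (volume.restrict (annulus n a)) = 0 := by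
    intro f d hf
    rw [eLpNorm_congr_ae (g := 0) (by filter_upwards [hf] with x hx; simp [hx]), eLpNorm_zero]
  simp only [h2Dist, partialDeriv_const, e hu, e (weakPartial_ae_zero hu _),
    e (weakPartial_ae_zero (weakPartial_ae_zero hu _) _), Finset.sum_const_zero, add_zero]

/-- Non-zero constants are weak eigenfunctions for `λ = 0`. -/
theorem isWeakEigenfunction_of_ae_const (hn : 2 ≤ n) (ha₀ : 0 < a) (ha₁ : a < 1) (γ : ℝ)
    {u : Rn n → ℝ} {c : ℝ} (hc : c ≠ 0)
    (hu : u =ᵐ[volume.restrict (annulus n a)] fun _ => c) : IsWeakEigenfunction a γ 0 u := by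
  -- The constant sequence `c` is at `H²`-distance zero from `u` and realises both traces, `0` for
  -- the normal derivative and `c` for the boundary value.
  refine ⟨⟨memH2_of_ae_const hu, MemLp.zero, fun _ _ => c, fun _ => contDiff_const, ?_, ?_⟩, ?_,
    fun _ => c, ⟨memLp_const c, fun _ _ => c, fun _ => contDiff_const, ?_, ?_⟩, ?_⟩
  · simp [h2Dist_const_eq_zero hu]
  · simp
  · intro h
    have h1 : (fun _ : Rn n => c) =ᵐ[volume.restrict (annulus n a)] fun _ => 0 := hu.symm.trans h
    have h2 := Measure.eqOn_open_of_ae_eq h1 isOpen_annulus continuousOn_const continuousOn_const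
    obtain ⟨x, hx⟩ := annulus_nonempty hn ha₀ ha₁
    exact hc (h2 hx)
  · simp [h2Dist_const_eq_zero hu]
  · simp
  · intro v h _ _
    have hL : weakLaplacian (annulus n a) u =ᵐ[volume.restrict (annulus n a)] 0 := by
      have := eventually_countable_forall.2 fun i =>
        weakPartial_ae_zero (weakPartial_ae_zero hu i) i
      filter_upwards [this] with x hx
      simp [weakLaplacian, hx]
    rw [bilapForm, integral_congr_ae (g := fun _ => (0 : ℝ))
      (by filter_upwards [hL] with x hx; simp [hx])]
    simp

/-! ### Classical eigenfunctions -/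

theorem partialDeriv_congr {f g : Rn n → ℝ} {x : Rn n} (h : f =ᶠ[𝓝 x] g) (i : Fin n) :
    partialDeriv i f x = partialDeriv i g x := by
  rw [partialDeriv, partialDeriv, h.fderiv_eq]

theorem contDiffOn_partialDeriv {f : Rn n → ℝ} {m k : WithTop ℕ∞} (hf : ContDiffOn ℝ m f (annulus n a))
    (hk : k + 1 ≤ m) (i : Fin n) : ContDiffOn ℝ k (partialDeriv i f) (annulus n a) :=
  (hf.fderiv_of_isOpen isOpen_annulus hk).clm_apply contDiffOn_const

theorem partialDeriv_eq_fderivWithin {f : Rn n → ℝ} {x : Rn n} (hx : x ∈ annulus n a) (i : Fin n) :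
    partialDeriv i f x = fderivWithin ℝ f (closedAnnulus n a) x (EuclideanSpace.single i 1) := by
  rw [partialDeriv, fderivWithin_of_mem_nhds (closedAnnulus_mem_nhds hx)]

theorem laplacian_eq_sum {f : Rn n → ℝ} {x : Rn n} (hf : ContDiffAt ℝ 2 f x) :
    Laplacian.laplacian f x = ∑ i, partialDeriv i (partialDeriv i f) x := by
  rw [InnerProductSpace.laplacian_eq_iteratedFDeriv_orthonormalBasis f
    (EuclideanSpace.basisFun (Fin n) ℝ)]
  refine Finset.sum_congr rfl fun i _ => ?_
  have hd : DifferentiableAt ℝ (fderiv ℝ f) x :=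
    (hf.fderiv_right (m := 1) (by norm_num)).differentiableAt (by simp)
  rw [iteratedFDeriv_two_apply]
  have h : partialDeriv i (partialDeriv i f) x = fderiv ℝ
      (fun y => fderiv ℝ f y (EuclideanSpace.single i 1)) x (EuclideanSpace.single i 1) := rfl
  rw [h, fderiv_clm_apply hd (differentiableAt_const _)]
  simp

theorem integral_boundary_eq_zero (ha₀ : 0 < a) {g : Rn n → ℝ}
    (hg : ∀ x ∈ annulusBoundary n a, g x = 0) : ∫ x, g x ∂(boundaryMeasure n a) = 0 := by
  rw [← integral_zero (Rn n) ℝ (μ := boundaryMeasure n a)]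
  exact integral_congr_ae ((ae_boundaryMeasure ha₀).mono hg)

theorem integrableOn_annulus_of_continuousOn {g : Rn n → ℝ} (hg : ContinuousOn g (closedAnnulus n a)) :
    IntegrableOn g (annulus n a) :=
  (hg.integrableOn_compact isCompact_closedAnnulus).mono_set annulus_subset_closedAnnulus

/-- Harmonic functions on the annulus with vanishing normal derivative are constant. -/
theorem eqOn_const_of_harmonic_of_neumann (hn : 2 ≤ n) (ha₀ : 0 < a) (ha₁ : a < 1) {v : Rn n → ℝ}
    (hK : ContDiffOn ℝ 1 v (closedAnnulus n a)) (hΩ : ContDiffOn ℝ 2 v (annulus n a))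
    (hΔ : ∀ x ∈ annulus n a, ∑ i, partialDeriv i (partialDeriv i v) x = 0)
    (hν : ∀ x ∈ annulusBoundary n a,
      fderivWithin ℝ v (closedAnnulus n a) x (outwardNormal a x) = 0) :
    ∃ c : ℝ, EqOn v (fun _ => c) (closedAnnulus n a) := by
  set K := closedAnnulus n a
  have hcont : ∀ i, ContinuousOn
      (fun x => fderivWithin ℝ v K x (EuclideanSpace.single i 1)) K := fun i =>
    (hK.continuousOn_fderivWithin (uniqueDiffOn_closedAnnulus ha₀ ha₁) le_rfl).clm_apply
      continuousOn_const
  -- The field `v ∇v` has divergence `|∇v|² + v Δv = |∇v|²` and flux density `v ∂_ν v = 0`.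
  -- Derivatives within the closed annulus make it continuous up to the boundary.
  set F : Fin n → Rn n → ℝ := fun i x => v x * fderivWithin ℝ v K x (EuclideanSpace.single i 1)
  have hFe : ∀ i, EqOn (F i) (fun x => v x * partialDeriv i v x) (annulus n a) := by
    intro i x hx
    simp only [F, partialDeriv_eq_fderivWithin hx, K]
  have hp : ∀ i, ContDiffOn ℝ 1 (partialDeriv i v) (annulus n a) := fun i =>
    contDiffOn_partialDeriv hΩ (by norm_num) i
  have hdv : ∀ x ∈ annulus n a, DifferentiableAt ℝ v x := fun x hx =>
    (hΩ.differentiableOn (by simp)).differentiableAt (isOpen_annulus.mem_nhds hx)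
  set S : Rn n → ℝ := fun x => ∑ i, fderivWithin ℝ v K x (EuclideanSpace.single i 1) ^ 2
  have hSc : ContinuousOn S K := continuousOn_finsetSum _ fun i _ => (hcont i).pow 2
  have hdiv : EqOn (divergence F) S (annulus n a) := by
    intro x hx
    have e : ∀ i, partialDeriv i (F i) x =
        v x * partialDeriv i (partialDeriv i v) x + partialDeriv i v x * partialDeriv i v x := by
      intro i
      rw [partialDeriv_congr ((hFe i).eventuallyEq_of_mem (isOpen_annulus.mem_nhds hx)),
        partialDeriv_mul (hdv x hx) (((hp i).differentiableOn (by simp)).differentiableAt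
          (isOpen_annulus.mem_nhds hx))]
    simp only [divergence, e, Finset.sum_add_distrib, ← Finset.mul_sum, hΔ x hx, mul_zero, zero_add,
      S, ← partialDeriv_eq_fderivWithin hx, K, pow_two]
  have key := integral_divergence hn ha₀ ha₁ (F := F) (fun i => hK.continuousOn.mul (hcont i))
    (fun i => ((hΩ.of_le (by norm_num)).mul (hp i)).congr (hFe i))
    (IntegrableOn.congr_fun (integrableOn_annulus_of_continuousOn hSc) hdiv.symm isOpen_annulus.measurableSet)
  rw [integral_boundary_eq_zero ha₀, setIntegral_congr_fun isOpen_annulus.measurableSet hdiv,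
    integral_eq_zero_iff_of_nonneg (fun x => Finset.sum_nonneg fun i _ => sq_nonneg _)
      (integrableOn_annulus_of_continuousOn hSc)] at key
  swap
  · intro x hx
    rw [← mul_zero (v x), ← hν x hx, clm_apply_eq_sum, Finset.mul_sum]
    exact Finset.sum_congr rfl fun i _ => by simp only [F]; ring
  -- Continuity turns the a.e. vanishing of `|∇v|²` into vanishing at every interior point.
  have hS0 := Measure.eqOn_open_of_ae_eq key isOpen_annulus
    (hSc.mono annulus_subset_closedAnnulus) continuousOn_const
  have hfd : EqOn (fderiv ℝ v) 0 (annulus n a) := by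
    intro x hx
    ext w
    rw [clm_apply_eq_sum]
    refine Finset.sum_eq_zero fun i _ => ?_
    have := (Finset.sum_eq_zero_iff_of_nonneg fun i _ => sq_nonneg _).1 (hS0 hx) i
      (Finset.mem_univ i)
    have h2 := partialDeriv_eq_fderivWithin (f := v) hx i
    rw [pow_eq_zero_iff two_ne_zero] at this
    rw [partialDeriv, this] at h2
    rw [h2, mul_zero]
  obtain ⟨c, hc⟩ := isOpen_annulus.exists_is_const_of_fderiv_eq_zero
    (isPreconnected_annulus hn ha₀) (hΩ.differentiableOn (by simp)) hfd
  exact ⟨c, EqOn.of_subset_closure hc hK.continuousOn continuousOn_const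
    annulus_subset_closedAnnulus (closedAnnulus_subset_closure ha₀ ha₁)⟩

theorem laplacianWithin_eq_sum (ha₀ : 0 < a) (ha₁ : a < 1) (u : Rn n → ℝ) {x : Rn n}
    (hx : x ∈ closedAnnulus n a) :
    InnerProductSpace.laplacianWithin u (closedAnnulus n a) x =
      ∑ i : Fin n, fderivWithin ℝ (fderivWithin ℝ u (closedAnnulus n a)) (closedAnnulus n a) x
        (EuclideanSpace.single i 1) (EuclideanSpace.single i 1) := by
  have hU := uniqueDiffOn_closedAnnulus (n := n) ha₀ ha₁
  rw [InnerProductSpace.laplacianWithin_eq_iteratedFDerivWithin_orthonormalBasis u hU hx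
    (EuclideanSpace.basisFun (Fin n) ℝ)]
  refine Finset.sum_congr rfl fun i _ => ?_
  rw [iteratedFDerivWithin_two_apply u hU hx]
  simp

/-- This links the interior equation, stated with the full Laplacian, to the third-order boundary
condition, stated with the Laplacian within the closed annulus. -/
theorem laplacianWithin_eq_laplacian (ha₀ : 0 < a) (ha₁ : a < 1) (u : Rn n → ℝ) :
    EqOn (InnerProductSpace.laplacianWithin u (closedAnnulus n a)) (Laplacian.laplacian u)
      (annulus n a) := by
  intro x hx
  have h : fderivWithin ℝ u (closedAnnulus n a) =ᶠ[𝓝 x] fderiv ℝ u := by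
    filter_upwards [isOpen_annulus.mem_nhds hx] with z hz
    exact fderivWithin_of_mem_nhds (closedAnnulus_mem_nhds hz)
  rw [laplacianWithin_eq_sum ha₀ ha₁ u (annulus_subset_closedAnnulus hx),
    fderivWithin_of_mem_nhds (closedAnnulus_mem_nhds hx), h.fderiv_eq,
    InnerProductSpace.laplacian_eq_iteratedFDeriv_orthonormalBasis u
      (EuclideanSpace.basisFun (Fin n) ℝ)]
  simp [iteratedFDeriv_two_apply]

/-- Classical eigenfunctions for `λ = 0` are constant. -/
theorem IsClassicalEigenfunction.eq_const (hn : 2 ≤ n) (ha₀ : 0 < a) (ha₁ : a < 1) {γ : ℝ}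
    {u : Rn n → ℝ} (hu : IsClassicalEigenfunction a γ 0 u) :
    ∃ c : ℝ, c ≠ 0 ∧ ∀ x ∈ closedAnnulus n a, u x = c := by
  have hU := uniqueDiffOn_closedAnnulus (n := n) ha₀ ha₁
  set K := closedAnnulus n a with hKdef
  set w := InnerProductSpace.laplacianWithin u K
  have hd1 : ContDiffOn ℝ 2 (fderivWithin ℝ u K) K :=
    hu.contDiffOn_closed.fderivWithin hU (by norm_num)
  have hd2 : ContDiffOn ℝ 1 (fderivWithin ℝ (fderivWithin ℝ u K) K) K :=
    hd1.fderivWithin hU (by norm_num)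
  have hwK : ContDiffOn ℝ 1 w K := by
    have h : ContDiffOn ℝ 1 (fun x => ∑ i : Fin n, fderivWithin ℝ (fderivWithin ℝ u K) K x
        (EuclideanSpace.single i 1) (EuclideanSpace.single i 1)) K := ContDiffOn.sum fun i _ =>
      (hd2.clm_apply contDiffOn_const).clm_apply contDiffOn_const
    exact h.congr fun x hx => laplacianWithin_eq_sum ha₀ ha₁ u hx
  have hat : ∀ x ∈ annulus n a, ContDiffAt ℝ 4 u x := fun x hx =>
    hu.contDiffOn_interior.contDiffAt (isOpen_annulus.mem_nhds hx)
  have hws : EqOn w (fun x => ∑ i, partialDeriv i (partialDeriv i u) x) (annulus n a) :=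
    fun x hx => (laplacianWithin_eq_laplacian ha₀ ha₁ u hx).trans
      (laplacian_eq_sum ((hat x hx).of_le (by norm_num)))
  have hwΩ : ContDiffOn ℝ 2 w (annulus n a) := by
    refine ContDiffOn.congr (ContDiffOn.sum fun i _ => ?_) hws
    exact contDiffOn_partialDeriv (contDiffOn_partialDeriv hu.contDiffOn_interior (k := 3)
      (by norm_num) i) (by norm_num) i
  -- At `λ = 0` the third-order condition is the Neumann condition for `w = Δu`.
  obtain ⟨c, hc⟩ := eqOn_const_of_harmonic_of_neumann hn ha₀ ha₁ hwK hwΩ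
    (fun x hx => by
      have hx' := isOpen_annulus.mem_nhds hx
      rw [← laplacian_eq_sum (hwΩ.contDiffAt hx'),
        (InnerProductSpace.laplacian_congr_nhds
          ((laplacianWithin_eq_laplacian ha₀ ha₁ u).eventuallyEq_of_mem hx')).eq_of_nhds,
        hu.equation x hx]
      simp)
    (fun x hx => by
      have := hu.third_order x hx
      simpa using this)
  have hF : ∀ i, ContDiffOn ℝ 2 (fun x => fderivWithin ℝ u K x (EuclideanSpace.single i 1)) K :=
    fun i => hd1.clm_apply contDiffOn_const
  have hFe : ∀ i : Fin n, EqOn (fun x => fderivWithin ℝ u K x (EuclideanSpace.single i 1))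
      (partialDeriv i u) (annulus n a) := fun i x hx => (partialDeriv_eq_fderivWithin hx i).symm
  have hdiv : EqOn (divergence fun i x => fderivWithin ℝ u K x (EuclideanSpace.single i 1))
      (fun _ => c) (annulus n a) := by
    intro x hx
    rw [← hc (annulus_subset_closedAnnulus hx), hws hx]
    exact Finset.sum_congr rfl fun i _ =>
      partialDeriv_congr ((hFe i).eventuallyEq_of_mem (isOpen_annulus.mem_nhds hx)) i
  -- For the field `∇u`, of divergence `c` and zero flux, this reads `c |Ω_a| = 0`.
  have key := integral_divergence hn ha₀ ha₁
    (F := fun i x => fderivWithin ℝ u K x (EuclideanSpace.single i 1))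
    (fun i => (hF i).continuousOn)
    (fun i => ((hF i).of_le (by norm_num)).mono annulus_subset_closedAnnulus)
    (IntegrableOn.congr_fun (integrable_const c) hdiv.symm
      isOpen_annulus.measurableSet)
  rw [integral_boundary_eq_zero ha₀, setIntegral_congr_fun isOpen_annulus.measurableSet hdiv,
    setIntegral_const, smul_eq_mul, mul_eq_zero] at key
  swap
  · intro x hx
    rw [← hu.neumann x hx, clm_apply_eq_sum]
    exact Finset.sum_congr rfl fun i _ => mul_comm _ _
  have hc0 : c = 0 := key.resolve_left
    (ENNReal.toReal_pos (volume_annulus_pos hn ha₀ ha₁).ne' volume_annulus_lt_top.ne).ne'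
  obtain ⟨d, hd⟩ := eqOn_const_of_harmonic_of_neumann hn ha₀ ha₁
    (hu.contDiffOn_closed.of_le (by norm_num)) (hu.contDiffOn_interior.of_le (by norm_num))
    (fun x hx => by
      rw [← hc0]
      exact (hws hx).symm.trans (hc (annulus_subset_closedAnnulus hx))) hu.neumann
  refine ⟨d, ?_, hd⟩
  obtain ⟨x, hx, hne⟩ := hu.ne_zero
  rwa [hd (annulus_subset_closedAnnulus hx)] at hne

/-- Non-zero constants are classical eigenfunctions for `λ = 0`. -/
theorem isClassicalEigenfunction_of_const (hn : 2 ≤ n) (ha₀ : 0 < a) (ha₁ : a < 1) (γ : ℝ)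
    {u : Rn n → ℝ} {c : ℝ} (hc : c ≠ 0) (hu : ∀ x ∈ closedAnnulus n a, u x = c) :
    IsClassicalEigenfunction a γ 0 u where
  contDiffOn_interior :=
    contDiffOn_const.congr fun x hx => hu x (annulus_subset_closedAnnulus hx)
  contDiffOn_closed := contDiffOn_const.congr hu
  ne_zero := by
    obtain ⟨x, hx⟩ := annulus_nonempty hn ha₀ ha₁
    exact ⟨x, hx, by rwa [hu x (annulus_subset_closedAnnulus hx)]⟩
  equation x hx := by
    -- `u` is arbitrary off the closed annulus, so the Laplacians are computed from equality near
    -- the interior point `x`.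
    have h : u =ᶠ[𝓝 x] fun _ => c := by
      filter_upwards [closedAnnulus_mem_nhds hx] with z hz using hu z hz
    have h1 := InnerProductSpace.laplacian_congr_nhds h
    rw [InnerProductSpace.laplacian_const] at h1
    rw [(InnerProductSpace.laplacian_congr_nhds h1).eq_of_nhds]
    have h0 := congrFun (InnerProductSpace.laplacian_const (E := Rn n) (c := (0 : ℝ))) x
    rw [zero_pow four_ne_zero, zero_mul]
    exact h0
  neumann x hx := by
    rw [fderivWithin_congr hu (hu x (annulusBoundary_subset ha₁ hx))]
    simp
  third_order x hx := by
    have hz : ∀ z ∈ closedAnnulus n a,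
        InnerProductSpace.laplacianWithin u (closedAnnulus n a) z = 0 := by
      intro z hz
      have h1 : ∀ y ∈ closedAnnulus n a, fderivWithin ℝ u (closedAnnulus n a) y = 0 := by
        intro y hy
        rw [fderivWithin_congr hu (hu y hy)]
        simp
      rw [laplacianWithin_eq_sum ha₀ ha₁ u hz, fderivWithin_congr h1 (h1 z hz)]
      simp
    rw [fderivWithin_congr hz (hz x (annulusBoundary_subset ha₁ hx))]
    simp

end BulkBoundary

end

theorem mainTheorem10 (n : ℕ) (hn : 2 ≤ n) (a : ℝ) (ha₀ : 0 < a) (ha₁ : a < 1)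
    (γ : ℝ) (hγ : 0 < γ) (u : BulkBoundary.Rn n → ℝ) :
    (BulkBoundary.IsWeakEigenfunction a γ 0 u ↔
      ∃ c : ℝ, c ≠ 0 ∧ u =ᵐ[volume.restrict (BulkBoundary.annulus n a)] fun _ => c) ∧
    (BulkBoundary.IsClassicalEigenfunction a γ 0 u ↔
      ∃ c : ℝ, c ≠ 0 ∧ ∀ x ∈ BulkBoundary.closedAnnulus n a, u x = c) := by
  refine ⟨⟨fun h => h.ae_eq_const hn ha₀ ha₁, ?_⟩, ⟨fun h => h.eq_const hn ha₀ ha₁, ?_⟩⟩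
  · rintro ⟨c, hc, hu⟩
    exact BulkBoundary.isWeakEigenfunction_of_ae_const hn ha₀ ha₁ γ hc hu
  · rintro ⟨c, hc, hu⟩
    exact BulkBoundary.isClassicalEigenfunction_of_const hn ha₀ ha₁ γ hc hu
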